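/- In the two-party public-coin communication model, Alice and Bob hold private inputs $X$ and $Y$ and share a uniformly random bit string of unlimited length. They exchange bits over an unlimited number of rounds, after which one of them, fixed in advance, outputs a value. The expected communication cost of a protocol is the maximum over inputs $(X,Y)$ of the expected total number of bits exchanged. A protocol is zero-error for a function $F$ if on every input $(X,Y)$ it outputs $F(X,Y)$ with probability $1$. The randomized zero-error communication complexity of $F$ is the minimum (infimum) expected communication cost of a zero-error protocol for $F$. For $n,k\in\mathbb N$ and $f:[n]\to\{0,1\}$, where $[n]=\{1,\dots,n\}$, in the $k$-step pointer chasing problem $\mathrm{PC}^f_{n,k}$ Alice holds $N_A:[n]\to[n]$, Bob holds $N_B:[n]\to[n]$, and the value to be computed is $f(v_k)$, where $v_0=1$ and, for $1\le t\le k$, $v_t=N_A(v_{t-1})$ if $t$ is odd and $v_t=N_B(v_{t-1})$ if $t$ is even. The function $f$ is called non-trivial if there are $i,j\in[n]\setminus\{1\}$ with $f(i)\ne f(j)$. **Theorem.** Let $n,k\in\mathbb N$ be such that $4k\le n$, and let $f:[n]\to\{0,1\}$ be non-trivial. Then the randomized zero-error communication complexity of $\mathrm{PC}^f_{n,k}$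 is $\Omega(k\log\log k)$. That is, there are absolute constants $c>0$ and $k_0$ such that for all $k\ge k_0$, all $n\ge 4k$ and all non-trivial $f:[n]\to\{0,1\}$, this complexity is at least $c\,k\log\log k$. -/

import Mathlib

open MeasureTheory
open scoped ENNReal

namespace PointerChasing

/-! ### Two-party communication protocols -/

/-- The two players. -/
inductive Player where
  | alice
  | bob

/-- The type of the private input of a player, when Alice's inputs range over `X` and Bob's
over `Y`. -/
def Player.Input (p : Player) (X Y : Type) : Type :=
  match p with
  | .alice => X
  | .bob => Y

/-- The private input of a player on the input pair `(x, y)`. -/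
def Player.input {X Y : Type} (p : Player) (x : X) (y : Y) : p.Input X Y :=
  match p with
  | .alice => x
  | .bob => y

/-- A deterministic protocol with an unrestricted number of rounds, as a binary tree. At an inner
node the player who owns the node sends one bit, computed from that player's private input (and
from the transcript so far, that is, the node itself). At a leaf the protocol stops, and `out` is
the map that the player `p`, who is responsible for the output, applies to their own input. -/
inductive ProtocolTree (p : Player) (X Y Z : Type) where
  | leaf (out : p.Input X Y → Z) : ProtocolTree p X Y Z
  | aliceSends (bit : X → Bool) (next : Bool → ProtocolTree p X Y Z) : ProtocolTree p X Y Z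
  | bobSends (bit : Y → Bool) (next : Bool → ProtocolTree p X Y Z) : ProtocolTree p X Y Z

namespace ProtocolTree

variable {p : Player} {X Y Z : Type}

/-- The value that player `p` outputs on the input pair `(x, y)`. -/
def output : ProtocolTree p X Y Z → X → Y → Z
  | leaf out, x, y => out (p.input x y)
  | aliceSends bit next, x, y => (next (bit x)).output x y
  | bobSends bit next, x, y => (next (bit y)).output x y

/-- The total number of bits exchanged on the input pair `(x, y)`. -/
def cost : ProtocolTree p X Y Z → X → Y → ℕ
  | leaf _, _, _ => 0
  | aliceSends bit next, x, y => (next (bit x)).cost x y + 1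
  | bobSends bit next, x, y => (next (bit y)).cost x y + 1

end ProtocolTree

/-- The law of an infinite sequence of independent fair bits, the shared random string. -/
noncomputable def coinMeasure : Measure (ℕ → Bool) :=
  Measure.infinitePi fun _ : ℕ => (PMF.uniformOfFintype Bool).toMeasure

/-- A randomized public-coin protocol: the player responsible for the output is fixed in advance,
and the shared random string determines the deterministic protocol that the players run. For each
input pair the output and the number of bits exchanged are random variables. -/
structure PublicCoinProtocol (X Y Z : Type) where
  /-- The player who produces the output. -/
  outputPlayer : Player
  /-- The deterministic protocol that is run when the shared random string is `r`. -/
  tree : (ℕ → Bool) → ProtocolTree outputPlayer X Y Z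
  measurableSet_output : ∀ (x : X) (y : Y) (z : Z), MeasurableSet {r | (tree r).output x y = z}
  measurable_cost : ∀ (x : X) (y : Y), Measurable fun r => (tree r).cost x y

namespace PublicCoinProtocol

variable {X Y Z : Type}

/-- On every input pair the output is correct with probability at least `1 - ε`. -/
def ComputesWithError (P : PublicCoinProtocol X Y Z) (F : X → Y → Z) (ε : ℝ) : Prop :=
  ∀ (x : X) (y : Y), 1 - ε ≤ coinMeasure.real {r | (P.tree r).output x y = F x y}

/-- The expected communication cost: the worst case over the input pairs of the expected number
of bits exchanged. -/
noncomputable def expectedCost (P : PublicCoinProtocol X Y Z) : ℝ≥0∞ :=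
  ⨆ (x : X) (y : Y), ∫⁻ r, ((P.tree r).cost x y : ℝ≥0∞) ∂coinMeasure

end PublicCoinProtocol

/-- The randomized `ε`-error communication complexity of `F`: the least expected communication
cost of a public-coin protocol that computes `F` with error `ε`. -/
noncomputable def randomizedCC {X Y Z : Type} (F : X → Y → Z) (ε : ℝ) : ℝ≥0∞ :=
  ⨅ (P : PublicCoinProtocol X Y Z) (_ : P.ComputesWithError F ε), P.expectedCost

/-- The randomized zero-error communication complexity of `F`. -/
noncomputable def zeroErrorCC {X Y Z : Type} (F : X → Y → Z) : ℝ≥0∞ :=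
  randomizedCC F 0

/-! ### Pointer chasing

The vertex set `[n]` is `Fin n`; the distinguished vertex, labelled 1 in `[n] = {1, …, n}`, is
`0 : Fin n`. -/

/-- The endpoint of the `r`-step walk from `i` whose first step uses `NA`, the second `NB`, and so
on in alternation. -/
def walkA {n : ℕ} (NA NB : Fin n → Fin n) : ℕ → Fin n → Fin n
  | 0, i => i
  | r + 1, i => walkA NB NA r (NA i)

/-- The endpoint of the `r`-step walk from `i` whose first step uses `NB`. -/
def walkB {n : ℕ} (NA NB : Fin n → Fin n) (r : ℕ) (i : Fin n) : Fin n :=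
  walkA NB NA r i

theorem walkA_succ {n : ℕ} (NA NB : Fin n → Fin n) (r : ℕ) (i : Fin n) :
    walkA NA NB (r + 1) i = walkB NA NB r (NA i) := rfl

theorem walkB_succ {n : ℕ} (NA NB : Fin n → Fin n) (r : ℕ) (i : Fin n) :
    walkB NA NB (r + 1) i = walkA NA NB r (NB i) := rfl

/-- The `k`-step pointer chasing problem: Alice holds `NA`, Bob holds `NB`, and the value is `f`
of the endpoint of the `k`-step walk from the distinguished vertex on Alice's side. -/
def pointerChasing {n : ℕ} [NeZero n] (f : Fin n → Bool) (k : ℕ)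
    (NA NB : Fin n → Fin n) : Bool :=
  f (walkA NA NB k 0)

/-- `f` is non-constant on the vertices other than the distinguished one. -/
def NonTrivial {n : ℕ} [NeZero n] (f : Fin n → Bool) : Prop :=
  ∃ i j : Fin n, i ≠ 0 ∧ j ≠ 0 ∧ f i ≠ f j

end PointerChasing

/-!
Restrict pointer chasing to inputs that encode two permutations `a`, `b` of a set with `m = ⌊k /
2⌋` elements. Two vertices on which `f` differs, other than the start, serve as the target of the
walk and as a dead end, so that the answer says whether `b * a` is a single `m`-cycle, that is,
whether the union of `a` and `b`, as perfect matchings between two copies of the set, is a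
Hamiltonian cycle (`walkA_embedded`). With probability one the deterministic protocol selected by
the coins is correct on all inputs, and each of its leaves with the answer "Hamiltonian" isolates
a rectangle of Hamiltonian pairs. By Kraft's inequality its average cost over the Hamiltonian
pairs is at least the logarithm of their number, which is at least `m! ^ 2 / m`, divided by the
size of the largest rectangle of such pairs (`le_zeroErrorCC`). The theorem then follows from the
bound `m! ^ 2 * exp (-c m log log m)` for the size of a rectangle of Hamiltonian pairs, a result
of Raz and Spieker (`card_mul_card_le_of_hamiltonian`).

For that bound, let `A × B` be a larger rectangle of Hamiltonian pairs and consider the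
alternating walk `Z 0, Z 1, …` of a uniformly random pair in `A × B` from a uniformly random
vertex. It is a stationary process whose first `2 m + 1` values determine the outcome, so that its
entropy rate is within `κ₁ = 4 + c log log m` of the logarithm of the size `n` of the alphabet, up
to length `m`. Because `A × B` is a rectangle, `Z i` and `Z j` have disjoint supports given the
values strictly between them: otherwise `a` from one pair and `b` from another would close a short
cycle (`walkProcess_ne`).

These properties bound `m` by a double exponential in `κ₁` (`lt_exp_exp_of_le_blockRate`). The
entropy rate given the last `d` values decreases in `d` and varies by at most `κ₁`; so it is
almost constant between two scales `d` and `ρ d`, where `ρ` and the number of scales are `exp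
(O(κ₁))`. On such a plateau a block of `d` values before, or after, a coordinate determines the
conditional law of that coordinate almost as well as all values of the window before, or after,
it. Let `A s` be the set of values of density between `1 / 10` and `κ = exp (O(κ₁))` in the law of
`Z (j s)` given the block before it, for times `j 0 < j 1 < …`. As the conditional supports are
disjoint, `Z (j s)` seldom falls into `A s'` for `s < s'`, unless its law given the block after it
is concentrated, which has small probability by the entropy bound. So `Z (j s)` often falls into
the part `D s` of `A s` outside all later `A s'`. The later blocks have a small entropy deficit;
for suitably chosen times they therefore carry little information about `Z (j s)` given its past,
so that the probability of falling into `D s` is about the measure of `D s` under a law of density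
at most `κ`. The sets `D s` are disjoint, hence there are only `O(κ)` of them, and taking more
times than that is a contradiction (`lt_blockRate_sub`).
-/

/-! ### Entropies and conditional laws of coordinates -/

namespace CoordEntropy

open Finset

variable {Ω S : Type*} [Fintype Ω]

open Classical in
/-- The outcomes that agree with `ω` on the coordinates in `I`. -/
noncomputable def cell (Z : ℕ → Ω → S) (I : Finset ℕ) (ω : Ω) : Finset Ω :=
  univ.filter fun ω' => ∀ k ∈ I, Z k ω' = Z k ω

open Classical in
/-- The conditional law of `Z i` given the coordinates in `I`, at the outcome `ω`, for the uniform
measure on `Ω`. -/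
noncomputable def law (Z : ℕ → Ω → S) (i : ℕ) (I : Finset ℕ) (ω : Ω) (v : S) : ℝ :=
  ((cell Z I ω).filter fun ω' => Z i ω' = v).card / (cell Z I ω).card

/-- The Shannon entropy, in nats, of the coordinates in `I`, for the uniform measure on `Ω`. -/
noncomputable def ent (Z : ℕ → Ω → S) (I : Finset ℕ) : ℝ :=
  (∑ ω, Real.log (Fintype.card Ω / (cell Z I ω).card)) / Fintype.card Ω

/-- The conditional entropy of `Z i` given the coordinates in `I`. -/
noncomputable def condEnt (Z : ℕ → Ω → S) (i : ℕ) (I : Finset ℕ) : ℝ :=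
  ent Z (insert i I) - ent Z I

variable {Z : ℕ → Ω → S} {I J : Finset ℕ} {i : ℕ} {ω ω' : Ω} {v : S}

theorem mem_cell : ω' ∈ cell Z I ω ↔ ∀ k ∈ I, Z k ω' = Z k ω := by simp [cell]

theorem self_mem_cell : ω ∈ cell Z I ω := by simp [mem_cell]

theorem mem_cell_comm : ω' ∈ cell Z I ω ↔ ω ∈ cell Z I ω' := by
  simp only [mem_cell]; exact forall₂_congr fun _ _ => eq_comm

theorem cell_subset (h : I ⊆ J) : cell Z J ω ⊆ cell Z I ω := fun _ hx =>
  mem_cell.2 fun k hk => mem_cell.1 hx k (h hk)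

theorem cell_eq_of_mem (h : ω' ∈ cell Z I ω) : cell Z I ω' = cell Z I ω := by
  ext x
  rw [mem_cell, mem_cell]
  rw [mem_cell] at h
  exact forall₂_congr fun k hk => by rw [h k hk]

theorem cell_card_pos : (0 : ℝ) < (cell Z I ω).card :=
  Nat.cast_pos.2 (card_pos.2 ⟨ω, self_mem_cell⟩)

theorem card_pos_of_mem (ω : Ω) : (0 : ℝ) < Fintype.card Ω :=
  Nat.cast_pos.2 (Fintype.card_pos_iff.2 ⟨ω⟩)

theorem law_congr (hI : I ⊆ J) (h : ω' ∈ cell Z J ω) : law Z i I ω' = law Z i I ω := by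
  funext v; simp only [law, cell_eq_of_mem (cell_subset hI h)]

theorem law_nonneg : 0 ≤ law Z i I ω v := by unfold law; positivity

open Classical in
theorem law_self : law Z i I ω (Z i ω) = (cell Z (insert i I) ω).card / (cell Z I ω).card := by
  have : (cell Z I ω).filter (fun ω' => Z i ω' = Z i ω) = cell Z (insert i I) ω := by
    ext x; simp [mem_cell, and_comm]
  rw [← this]
  rfl

theorem law_self_pos : 0 < law Z i I ω (Z i ω) := by
  rw [law_self]; exact div_pos cell_card_pos cell_card_pos

theorem law_pos_iff : 0 < law Z i I ω v ↔ ∃ ω' ∈ cell Z I ω, Z i ω' = v := by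
  classical
  unfold law
  rw [div_pos_iff_of_pos_right cell_card_pos, Nat.cast_pos, card_pos, filter_nonempty_iff]

theorem law_pos_mono (hI : I ⊆ J) (h : 0 < law Z i J ω v) : 0 < law Z i I ω v := by
  rw [law_pos_iff] at *
  obtain ⟨x, hx, hv⟩ := h
  exact ⟨x, cell_subset hI hx, hv⟩

theorem condEnt_eq : condEnt Z i I =
    (∑ ω, -Real.log (law Z i I ω (Z i ω))) / Fintype.card Ω := by
  unfold condEnt ent
  rw [← sub_div, ← sum_sub_distrib]
  congr 1
  refine sum_congr rfl fun ω _ => ?_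
  have := card_pos_of_mem ω
  have h1 := cell_card_pos (Z := Z) (I := I) (ω := ω)
  have h2 := cell_card_pos (Z := Z) (I := insert i I) (ω := ω)
  rw [law_self, Real.log_div this.ne' h1.ne', Real.log_div this.ne' h2.ne',
    Real.log_div h2.ne' h1.ne']
  ring

theorem ent_empty [Nonempty Ω] : ent Z ∅ = 0 := by
  have hN : (0 : ℝ) < Fintype.card Ω := Nat.cast_pos.2 Fintype.card_pos
  have : ∀ ω, cell Z ∅ ω = univ := fun ω => by ext; simp [mem_cell]
  simp [ent, this, card_univ, hN.ne']

variable [Fintype S]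

theorem sum_law (Z : ℕ → Ω → S) (i : ℕ) (I : Finset ℕ) (ω : Ω) : ∑ v, law Z i I ω v = 1 := by
  classical
  unfold law
  rw [← sum_div, div_eq_one_iff_eq cell_card_pos.ne', ← Nat.cast_sum]
  congr 1
  exact (card_eq_sum_card_fiberwise (f := Z i) (t := univ) fun x _ => by simp).symm

/-- The tower property: averaging `g ω v` over the conditional law of `Z i` is averaging
`g ω (Z i ω)`, when `g` depends on `ω` only through the conditioning coordinates. -/
theorem sum_sum_law_mul (g : Ω → S → ℝ) (hg : ∀ ω, ∀ ω' ∈ cell Z I ω, g ω' = g ω) :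
    ∑ ω, ∑ v, law Z i I ω v * g ω v = ∑ ω, g ω (Z i ω) := by
  classical
  have h1 : ∀ ω, ∑ v, law Z i I ω v * g ω v =
      ∑ ω', if ω' ∈ cell Z I ω then g ω' (Z i ω') / (cell Z I ω').card else 0 := by
    intro ω
    rw [← sum_filter, filter_mem_eq_inter, univ_inter]
    have h2 : ∀ ω' ∈ cell Z I ω, g ω' (Z i ω') / (cell Z I ω').card =
        g ω (Z i ω') / (cell Z I ω).card := fun ω' h => by
      rw [hg ω ω' h, cell_eq_of_mem h]
    rw [sum_congr rfl h2, ← sum_fiberwise (cell Z I ω) (Z i)]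
    refine sum_congr rfl fun v _ => ?_
    have h3 : ∀ x ∈ (cell Z I ω).filter (fun x => Z i x = v),
        g ω (Z i x) / (cell Z I ω).card = g ω v / (cell Z I ω).card := fun x hx => by
      rw [(mem_filter.1 hx).2]
    rw [sum_congr rfl h3, sum_const, nsmul_eq_mul, law]
    ring
  rw [sum_congr rfl fun ω _ => h1 ω, sum_comm]
  refine sum_congr rfl fun ω' _ => ?_
  simp only [mem_cell_comm (ω := _) (ω' := ω')]
  rw [← sum_filter, filter_mem_eq_inter, univ_inter, sum_const, nsmul_eq_mul,
    mul_div_cancel₀ _ cell_card_pos.ne']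

theorem sq_sqrt_sub_sqrt_le {p q : ℝ} (hp : 0 ≤ p) (hq : 0 ≤ q) (h : 0 < p → 0 < q) :
    (√p - √q) ^ 2 ≤ p * (Real.log p - Real.log q) - p + q := by
  rcases hp.eq_or_lt with rfl | hp'
  · simp [Real.sq_sqrt hq]
  · have hq' := h hp'
    have h1 : Real.log (√q / √p) ≤ √q / √p - 1 :=
      Real.log_le_sub_one_of_pos (div_pos (Real.sqrt_pos.2 hq') (Real.sqrt_pos.2 hp'))
    rw [Real.log_div (Real.sqrt_pos.2 hq').ne' (Real.sqrt_pos.2 hp').ne', Real.log_sqrt hq,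
      Real.log_sqrt hp] at h1
    have h2 : p * (√q / √p) = √p * √q := by
      rw [mul_div_assoc', div_eq_iff (Real.sqrt_pos.2 hp').ne']
      conv_lhs => rw [← Real.mul_self_sqrt hp]
      ring
    have h3 := mul_le_mul_of_nonneg_left h1 hp
    have h4 : (√p - √q) ^ 2 = p + q - 2 * (√p * √q) := by
      nlinarith [Real.mul_self_sqrt hp, Real.mul_self_sqrt hq]
    rw [h4]
    nlinarith

/-- The drop of the conditional entropy under further conditioning dominates the expected squared
Hellinger distance of the two conditional laws. -/
theorem sum_sq_sqrt_law_le [Nonempty Ω] (hI : I ⊆ J) :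
    ∑ ω, ∑ v, (√(law Z i J ω v) - √(law Z i I ω v)) ^ 2 ≤
      (condEnt Z i I - condEnt Z i J) * Fintype.card Ω := by
  have hN : (0 : ℝ) < Fintype.card Ω := Nat.cast_pos.2 Fintype.card_pos
  have h1 := sum_sum_law_mul (Z := Z) (I := J) (i := i)
    (fun ω v => Real.log (law Z i J ω v) - Real.log (law Z i I ω v)) fun ω ω' h => by
      simp only [law_congr subset_rfl h, law_congr hI h]
  have h2 : (condEnt Z i I - condEnt Z i J) * Fintype.card Ω =
      ∑ ω, (Real.log (law Z i J ω (Z i ω)) - Real.log (law Z i I ω (Z i ω))) := by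
    rw [condEnt_eq, condEnt_eq, ← sub_div, div_mul_cancel₀ _ hN.ne', ← sum_sub_distrib]
    exact sum_congr rfl fun ω _ => by ring
  rw [h2, ← h1]
  refine sum_le_sum fun ω _ => ?_
  calc ∑ v, (√(law Z i J ω v) - √(law Z i I ω v)) ^ 2
      ≤ ∑ v, (law Z i J ω v * (Real.log (law Z i J ω v) - Real.log (law Z i I ω v))
          - law Z i J ω v + law Z i I ω v) :=
        sum_le_sum fun v _ => sq_sqrt_sub_sqrt_le law_nonneg law_nonneg (law_pos_mono hI)
    _ = _ := by rw [sum_add_distrib, sum_sub_distrib, sum_law, sum_law]; ring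

theorem condEnt_anti [Nonempty Ω] (hI : I ⊆ J) : condEnt Z i J ≤ condEnt Z i I := by
  have h := sum_sq_sqrt_law_le (Z := Z) (i := i) hI
  have h0 : 0 ≤ ∑ ω, ∑ v, (√(law Z i J ω v) - √(law Z i I ω v)) ^ 2 :=
    sum_nonneg fun _ _ => sum_nonneg fun _ _ => sq_nonneg _
  have hN : (0 : ℝ) < Fintype.card Ω := Nat.cast_pos.2 Fintype.card_pos
  have := nonneg_of_mul_nonneg_left (h0.trans h) hN
  linarith

/-- A Pinsker inequality: conditional laws whose entropies nearly agree are close in `L¹`. -/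
theorem sum_abs_law_sub_le [Nonempty Ω] (hI : I ⊆ J) {τ : ℝ} (hτ : 0 < τ)
    (h : condEnt Z i I - condEnt Z i J ≤ τ ^ 2 / 4) :
    ∑ ω, ∑ v, |law Z i J ω v - law Z i I ω v| ≤ τ * Fintype.card Ω := by
  have hN : (0 : ℝ) < Fintype.card Ω := Nat.cast_pos.2 Fintype.card_pos
  have hpt : ∀ p q : ℝ, 0 ≤ p → 0 ≤ q →
      |p - q| ≤ 2 / τ * (√p - √q) ^ 2 + τ / 4 * (p + q) := by
    intro p q hp hq
    have e : p - q = (√p - √q) * (√p + √q) := by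
      nlinarith [Real.mul_self_sqrt hp, Real.mul_self_sqrt hq]
    have e2 : (√p + √q) ^ 2 ≤ 2 * (p + q) := by
      nlinarith [Real.mul_self_sqrt hp, Real.mul_self_sqrt hq, sq_nonneg (√p - √q)]
    have hs : 0 ≤ √p + √q := by positivity
    rw [e, abs_mul, abs_of_nonneg hs, ← sq_abs (√p - √q)]
    set x := |√p - √q|
    set y := √p + √q
    have h1 : x * y ≤ 2 / τ * x ^ 2 + τ / 8 * y ^ 2 := by
      have : 2 / τ * x ^ 2 + τ / 8 * y ^ 2 - x * y = 2 / τ * (x - τ / 4 * y) ^ 2 := by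
        field_simp; ring
      have h2 : 0 ≤ 2 / τ * (x - τ / 4 * y) ^ 2 := by positivity
      linarith
    nlinarith
  calc ∑ ω, ∑ v, |law Z i J ω v - law Z i I ω v|
      ≤ ∑ ω, ∑ v, (2 / τ * (√(law Z i J ω v) - √(law Z i I ω v)) ^ 2
          + τ / 4 * (law Z i J ω v + law Z i I ω v)) :=
        sum_le_sum fun ω _ => sum_le_sum fun v _ => hpt _ _ law_nonneg law_nonneg
    _ = 2 / τ * (∑ ω, ∑ v, (√(law Z i J ω v) - √(law Z i I ω v)) ^ 2)
          + τ / 2 * Fintype.card Ω := by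
        simp only [sum_add_distrib, ← mul_sum, sum_law, sum_const, card_univ, nsmul_eq_mul]
        ring
    _ ≤ 2 / τ * (τ ^ 2 / 4 * Fintype.card Ω) + τ / 2 * Fintype.card Ω := by
        gcongr
        exact (sum_sq_sqrt_law_le hI).trans (mul_le_mul_of_nonneg_right h hN.le)
    _ = τ * Fintype.card Ω := by field_simp; ring

theorem sum_law_mul_log [Nonempty Ω] :
    ∑ ω, ∑ v, law Z i I ω v * Real.log (Fintype.card S * law Z i I ω v) =
      (Real.log (Fintype.card S) - condEnt Z i I) * Fintype.card Ω := by
  have hN : (0 : ℝ) < Fintype.card Ω := Nat.cast_pos.2 Fintype.card_pos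
  have : Nonempty S := ⟨Z 0 (Classical.arbitrary Ω)⟩
  have hn : (0 : ℝ) < Fintype.card S := Nat.cast_pos.2 Fintype.card_pos
  rw [sum_sum_law_mul (Z := Z) (I := I) (i := i)
    (fun ω v => Real.log (Fintype.card S * law Z i I ω v)) fun ω ω' h => by
      simp only [law_congr subset_rfl h], condEnt_eq, sub_mul, div_mul_cancel₀ _ hN.ne',
    sum_congr rfl fun ω _ => Real.log_mul hn.ne' (law_self_pos (Z := Z)).ne', sum_add_distrib,
    sum_neg_distrib]
  simp only [sum_const, card_univ, nsmul_eq_mul]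
  ring

open Classical in
/-- The conditional law seldom exceeds `κ` times the uniform density. -/
theorem card_large_law_mul_log_le [Nonempty Ω] {κ : ℝ} (hκ : 1 ≤ κ) :
    (∑ ω, if κ < Fintype.card S * law Z i I ω (Z i ω) then (1 : ℝ) else 0) * Real.log κ ≤
      (Real.log (Fintype.card S) - condEnt Z i I + 1) * Fintype.card Ω := by
  have hN : (0 : ℝ) < Fintype.card Ω := Nat.cast_pos.2 Fintype.card_pos
  have : Nonempty S := ⟨Z 0 (Classical.arbitrary Ω)⟩
  have hn : (0 : ℝ) < Fintype.card S := Nat.cast_pos.2 Fintype.card_pos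
  set n : ℝ := (Fintype.card S : ℝ) with hndef
  have h1 := sum_sum_law_mul (Z := Z) (I := I) (i := i)
    (fun ω v => if κ < n * law Z i I ω v then Real.log κ else 0) fun ω ω' h => by
      simp only [law_congr subset_rfl h]
  have hpt : ∀ p : ℝ, 0 ≤ p → (p * if κ < n * p then Real.log κ else 0) ≤
      p * Real.log (n * p) + 1 / n := by
    intro p hp
    split_ifs with h
    · have : Real.log κ ≤ Real.log (n * p) := Real.log_le_log (by linarith) h.le
      have h4 := mul_le_mul_of_nonneg_left this hp
      have : 0 < 1 / n := by positivity
      linarith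
    · rcases hp.eq_or_lt with rfl | hp'
      · simp; positivity
      · have h5 := Real.one_sub_inv_le_log_of_pos (mul_pos hn hp')
        have h6 := mul_le_mul_of_nonneg_left h5 hp
        have h7 : p * (1 - (n * p)⁻¹) = p - 1 / n := by field_simp
        rw [h7] at h6
        linarith
  calc _ = ∑ ω, ∑ v, law Z i I ω v * (if κ < n * law Z i I ω v then Real.log κ else 0) := by
        rw [h1, sum_mul]
        exact sum_congr rfl fun ω _ => by split_ifs <;> simp
    _ ≤ ∑ ω, ∑ v, (law Z i I ω v * Real.log (n * law Z i I ω v) + 1 / n) :=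
        sum_le_sum fun ω _ => sum_le_sum fun v _ => hpt _ law_nonneg
    _ = _ := by
        simp only [sum_add_distrib]
        rw [hndef, sum_law_mul_log, ← hndef]
        simp only [sum_const, card_univ, nsmul_eq_mul]
        change _ + _ * (n * (1 / n)) = _
        field_simp

open Classical in
/-- The conditional law seldom falls below `θ` times the uniform density. -/
theorem card_small_law_le [Nonempty Ω] {θ : ℝ} (hθ : 0 ≤ θ) :
    (∑ ω, if Fintype.card S * law Z i I ω (Z i ω) < θ then (1 : ℝ) else 0) ≤
      θ * Fintype.card Ω := by
  have : Nonempty S := ⟨Z 0 (Classical.arbitrary Ω)⟩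
  have hn : (0 : ℝ) < Fintype.card S := Nat.cast_pos.2 Fintype.card_pos
  have h1 := sum_sum_law_mul (Z := Z) (I := I) (i := i)
    (fun ω v => if Fintype.card S * law Z i I ω v < θ then (1 : ℝ) else 0) fun ω ω' h => by
      simp only [law_congr subset_rfl h]
  rw [← h1]
  calc _ ≤ ∑ _ω : Ω, ∑ _v : S, θ / Fintype.card S := by
        refine sum_le_sum fun ω _ => sum_le_sum fun v _ => ?_
        split_ifs with h
        · rw [mul_one, le_div_iff₀ hn]; linarith
        · rw [mul_zero]; positivity
    _ = _ := by
        simp only [sum_const, card_univ, nsmul_eq_mul]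
        field_simp

theorem condEnt_le_log [Nonempty Ω] : condEnt Z i I ≤ Real.log (Fintype.card S) := by
  have hN : (0 : ℝ) < Fintype.card Ω := Nat.cast_pos.2 Fintype.card_pos
  have : Nonempty S := ⟨Z 0 (Classical.arbitrary Ω)⟩
  have hn : (0 : ℝ) < Fintype.card S := Nat.cast_pos.2 Fintype.card_pos
  have h4 : 0 ≤ ∑ ω, ∑ v, law Z i I ω v * Real.log (Fintype.card S * law Z i I ω v) := by
    refine sum_nonneg fun ω _ => ?_
    have : ∑ v, (law Z i I ω v - 1 / Fintype.card S) = 0 := by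
      rw [sum_sub_distrib, sum_law]
      simp
    rw [← this]
    refine sum_le_sum fun v _ => ?_
    rcases (law_nonneg (Z := Z) (i := i) (I := I) (ω := ω) (v := v)).eq_or_lt with h | h
    · rw [← h]; simp
    · have h5 := Real.one_sub_inv_le_log_of_pos (mul_pos hn h)
      have h6 := mul_le_mul_of_nonneg_left h5 h.le
      refine le_trans (le_of_eq ?_) h6
      field_simp
  rw [sum_law_mul_log] at h4
  have := nonneg_of_mul_nonneg_left h4 hN
  linarith

end CoordEntropy

/-! ### Stationary processes -/

namespace CoordEntropy

open Finset

variable {Ω S : Type*} [Fintype Ω] {Z : ℕ → Ω → S}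

/-- The conditional entropy of a coordinate of a stationary process given the preceding `d`. -/
noncomputable def blockRate (Z : ℕ → Ω → S) (d : ℕ) : ℝ := condEnt Z d (Ico 0 d)

/-- Stationarity, in the weak form used here: shifted blocks have equal entropies. -/
def Stationary (Z : ℕ → Ω → S) : Prop :=
  ∀ a b, ent Z (Ico (a + 1) (b + 1)) = ent Z (Ico a b)

theorem Stationary.ent_Ico (hst : Stationary Z) (a l : ℕ) :
    ent Z (Ico a (a + l)) = ent Z (Ico 0 l) := by
  induction a with
  | zero => simp
  | succ a ih => rw [← ih, ← hst a (a + l)]; congr 2; omega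

theorem blockRate_eq (Z : ℕ → Ω → S) (d : ℕ) :
    blockRate Z d = ent Z (Ico 0 (d + 1)) - ent Z (Ico 0 d) := by
  rw [blockRate, condEnt]
  congr 2
  ext k; simp only [mem_insert, mem_Ico]; omega

theorem Stationary.condEnt_before (hst : Stationary Z) {d i : ℕ} (h : d ≤ i) :
    condEnt Z i (Ico (i - d) i) = blockRate Z d := by
  rw [blockRate_eq, condEnt, ← hst.ent_Ico (i - d) d, ← hst.ent_Ico (i - d) (d + 1)]
  congr 2
  · ext k; simp only [mem_insert, mem_Ico]; omega
  · congr 1; omega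

theorem Stationary.condEnt_after (hst : Stationary Z) (d i : ℕ) :
    condEnt Z i (Ico (i + 1) (i + 1 + d)) = blockRate Z d := by
  rw [blockRate_eq, condEnt, ← hst.ent_Ico i (d + 1), ← hst.ent_Ico (i + 1) d]
  congr 2
  ext k; simp only [mem_insert, mem_Ico]; omega

theorem Stationary.blockRate_antitone [Nonempty Ω] [Fintype S] (hst : Stationary Z) :
    Antitone (blockRate Z) := by
  intro d e h
  rw [← hst.condEnt_before h, blockRate]
  exact condEnt_anti (Ico_subset_Ico (Nat.zero_le _) le_rfl)

theorem ent_union_le [Nonempty Ω] [Fintype S] (I Λ : Finset ℕ) :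
    ent Z (I ∪ Λ) ≤ ent Z I + Λ.card * Real.log (Fintype.card S) := by
  induction Λ using Finset.induction_on with
  | empty => simp
  | insert a Λ ha ih =>
    have h := condEnt_le_log (Z := Z) (i := a) (I := I ∪ Λ)
    rw [union_insert, card_insert_of_notMem ha]
    unfold condEnt at h
    push_cast
    linarith

theorem le_ent_union [Nonempty Ω] [Fintype S] {r : ℝ} {β w : ℕ}
    (hlow : ∀ e < w, r ≤ blockRate Z e) (Λ : Finset ℕ) (hΛ : ∀ k ∈ Λ, β ≤ k ∧ k < w) :
    ent Z (Ico 0 β) + Λ.card * r ≤ ent Z (Ico 0 β ∪ Λ) := by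
  induction Λ using Finset.induction_on_max with
  | empty => simp
  | insert a Λ hmax ih =>
    have ha : a ∉ Λ := fun h => lt_irrefl _ (hmax a h)
    have h1 := ih fun k hk => hΛ k (mem_insert_of_mem hk)
    have h2 := hΛ a (mem_insert_self _ _)
    have h3 : condEnt Z a (Ico 0 a) ≤ condEnt Z a (Ico 0 β ∪ Λ) := by
      apply condEnt_anti
      intro k hk
      rw [mem_union, mem_Ico] at hk
      rw [mem_Ico]
      rcases hk with hk | hk
      · omega
      · exact ⟨Nat.zero_le _, hmax k hk⟩
    have h4 := hlow a h2.2
    rw [union_insert, card_insert_of_notMem ha]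
    unfold blockRate at h4
    unfold condEnt at h3 h4
    push_cast
    linarith

/-- A set `Λ` of later coordinates carries little information about most coordinates of a long
interval: by the chain rule the total over the interval is at most the entropy deficit of `Λ`. -/
theorem exists_condEnt_sub_le [Nonempty Ω] [Fintype S] {κ₁ : ℝ} {α N w : ℕ} (hN : 0 < N)
    (hlow : ∀ e < w, Real.log (Fintype.card S) - κ₁ ≤ blockRate Z e) (Λ : Finset ℕ)
    (hΛ : ∀ k ∈ Λ, α + N ≤ k ∧ k < w) :
    ∃ i, α ≤ i ∧ i < α + N ∧
      condEnt Z i (Ico 0 i) - condEnt Z i (Ico 0 i ∪ Λ) ≤ Λ.card * κ₁ / N := by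
  have hins : ∀ i (Λ : Finset ℕ), insert i (Ico 0 i ∪ Λ) = Ico 0 (i + 1) ∪ Λ := by
    intro i Λ
    ext k; simp only [mem_insert, mem_union, mem_Ico]
    constructor
    · rintro (h | h | h)
      · left; omega
      · left; omega
      · right; exact h
    · rintro (h | h)
      · rcases Nat.lt_succ_iff_lt_or_eq.1 h.2 with h' | h'
        · right; left; omega
        · left; exact h'
      · right; right; exact h
  have htel : ∀ Λ : Finset ℕ, ∑ i ∈ range N, condEnt Z (α + i) (Ico 0 (α + i) ∪ Λ) =
      ent Z (Ico 0 (α + N) ∪ Λ) - ent Z (Ico 0 α ∪ Λ) := by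
    intro Λ
    have := Finset.sum_range_sub (fun i => ent Z (Ico 0 (α + i) ∪ Λ)) N
    rw [Nat.add_zero] at this
    rw [← this]
    refine sum_congr rfl fun i _ => ?_
    rw [condEnt, hins]; rfl
  have h1 := htel Λ
  have h2 := htel ∅
  simp only [union_empty] at h2
  have h3 := ent_union_le (Z := Z) (Ico 0 α) Λ
  have h4 := le_ent_union hlow Λ hΛ
  have hNR : (0 : ℝ) < N := Nat.cast_pos.2 hN
  have h5 : ∑ i ∈ range N, (condEnt Z (α + i) (Ico 0 (α + i)) -
      condEnt Z (α + i) (Ico 0 (α + i) ∪ Λ)) ≤ ∑ _i ∈ range N, Λ.card * κ₁ / N := by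
    rw [sum_sub_distrib, h1, h2, sum_const, card_range, nsmul_eq_mul, mul_div_cancel₀ _ hNR.ne']
    linarith
  obtain ⟨i, hi, h⟩ := exists_le_of_sum_le (nonempty_range_iff.2 hN.ne') h5
  rw [mem_range] at hi
  exact ⟨α + i, by omega, by omega, h⟩

open Classical in
/-- If, given the coordinates strictly between `i` and `j`, the conditional laws of `Z i` and
`Z j` have disjoint supports, and if these laws are determined up to a small error by `R` and `L`,
then `Z i` seldom falls where the law of `Z j` given `L` is large, unless the law of `Z i` given
`R` is concentrated there. -/
theorem sum_overlap_le [Nonempty Ω] [Fintype S] {i j : ℕ} {L R : Finset ℕ} {θ κ τ : ℝ}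
    (hθ : 0 < θ) (hκ : 0 ≤ κ) (hτ : 0 < τ)
    (hfree : ∀ ω ω', (∀ k ∈ Ico (i + 1) j, Z k ω = Z k ω') → Z i ω ≠ Z j ω')
    (hL : L ⊆ Ico (i + 1) j) (hR : R ⊆ Ico (i + 1) j)
    (hgL : condEnt Z j L - condEnt Z j (Ico (i + 1) j) ≤ τ ^ 2 / 4)
    (hgR : condEnt Z i R - condEnt Z i (Ico (i + 1) j) ≤ τ ^ 2 / 4) :
    (∑ ω, if θ ≤ Fintype.card S * law Z j L ω (Z i ω) ∧
        Fintype.card S * law Z i R ω (Z i ω) ≤ κ then (1 : ℝ) else 0) ≤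
      (1 + κ / θ) * τ * Fintype.card Ω := by
  have : Nonempty S := ⟨Z 0 (Classical.arbitrary Ω)⟩
  have hn : (0 : ℝ) < Fintype.card S := Nat.cast_pos.2 Fintype.card_pos
  set W := Ico (i + 1) j with hW
  set n : ℝ := (Fintype.card S : ℝ) with hndef
  have h1 := sum_sum_law_mul (Z := Z) (I := W) (i := i)
    (fun ω v => if (θ ≤ n * law Z j L ω v ∧ n * law Z i R ω v ≤ κ) ∧ law Z j W ω v = 0
      then (1 : ℝ) else 0) fun ω ω' h => by
      simp only [law_congr hL h, law_congr hR h, law_congr subset_rfl h]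
  have h0 : ∀ ω, law Z j W ω (Z i ω) = 0 := by
    intro ω
    by_contra hne
    obtain ⟨ω', hm, hv⟩ := law_pos_iff.1 (lt_of_le_of_ne law_nonneg (Ne.symm hne))
    exact hfree ω ω' (fun k hk => (mem_cell.1 hm k hk).symm) hv.symm
  simp only [h0, and_true] at h1
  rw [← h1]
  calc _ ≤ ∑ ω, ∑ v, (|law Z i W ω v - law Z i R ω v| +
          κ / θ * |law Z j W ω v - law Z j L ω v|) := by
        refine sum_le_sum fun ω _ => sum_le_sum fun v _ => ?_
        split_ifs with h
        · obtain ⟨⟨ha, hb⟩, hc⟩ := h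
          have hd := le_abs_self (law Z i W ω v - law Z i R ω v)
          rw [hc, zero_sub, abs_neg, abs_of_nonneg law_nonneg, mul_one]
          have he : law Z i R ω v ≤ κ / θ * law Z j L ω v := by
            rw [div_mul_eq_mul_div, le_div_iff₀ hθ]
            have h6 := mul_le_mul_of_nonneg_left ha hκ
            have h7 := mul_le_mul_of_nonneg_right hb hθ.le
            refine le_of_mul_le_mul_left ?_ hn
            nlinarith
          linarith
        · rw [mul_zero]; positivity
    _ = ∑ ω, ∑ v, |law Z i W ω v - law Z i R ω v| +
          κ / θ * ∑ ω, ∑ v, |law Z j W ω v - law Z j L ω v| := by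
        simp only [sum_add_distrib, mul_sum]
    _ ≤ τ * Fintype.card Ω + κ / θ * (τ * Fintype.card Ω) := by
        gcongr
        · exact sum_abs_law_sub_le hR hτ hgR
        · exact sum_abs_law_sub_le hL hτ hgL
    _ = _ := by ring

open Classical in
/-- A random set of density at most `κ` under the law given `L`, when this law barely changes
under the further conditioning on `G` that determines the set. -/
theorem sum_mem_le [Nonempty Ω] [Fintype S] {i : ℕ} {L G : Finset ℕ} {κ τ : ℝ}
    (hτ : 0 < τ) (hLG : L ⊆ G) (hg : condEnt Z i L - condEnt Z i G ≤ τ ^ 2 / 4)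
    (D : Ω → S → Prop) (hD : ∀ ω, ∀ ω' ∈ cell Z G ω, D ω' = D ω)
    (hDκ : ∀ ω v, D ω v → Fintype.card S * law Z i L ω v ≤ κ) :
    (∑ ω, if D ω (Z i ω) then (1 : ℝ) else 0) ≤ τ * Fintype.card Ω +
      κ / Fintype.card S * ∑ ω, ∑ v, if D ω v then (1 : ℝ) else 0 := by
  have : Nonempty S := ⟨Z 0 (Classical.arbitrary Ω)⟩
  have hn : (0 : ℝ) < Fintype.card S := Nat.cast_pos.2 Fintype.card_pos
  rw [← sum_sum_law_mul (Z := Z) (I := G) (i := i) (fun ω v => if D ω v then (1 : ℝ) else 0)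
    fun ω ω' h => by simp only [hD ω ω' h]]
  calc _ ≤ ∑ ω, ∑ v, (|law Z i G ω v - law Z i L ω v| +
          κ / Fintype.card S * if D ω v then (1 : ℝ) else 0) := by
        refine sum_le_sum fun ω _ => sum_le_sum fun v _ => ?_
        split_ifs with h
        · have h1 := le_abs_self (law Z i G ω v - law Z i L ω v)
          have h2 := hDκ ω v h
          have h3 : law Z i L ω v ≤ κ / Fintype.card S := by
            rw [le_div_iff₀ hn]; linarith
          linarith
        · simp
    _ = ∑ ω, ∑ v, |law Z i G ω v - law Z i L ω v| +
          κ / Fintype.card S * ∑ ω, ∑ v, if D ω v then (1 : ℝ) else 0 := by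
        simp only [sum_add_distrib, mul_sum]
    _ ≤ _ := by
        gcongr
        exact sum_abs_law_sub_le hLG hτ hg

end CoordEntropy

/-! ### The drop of the entropy rate across scales -/

namespace CoordEntropy

open Finset

variable {Ω S : Type*} [Fintype Ω] {Z : ℕ → Ω → S}

/-- The blocks of length `d` that end just before the times `j s'`, for `s < s' < t`. -/
def laterBlocks (t d : ℕ) (j : ℕ → ℕ) (s : ℕ) : Finset ℕ :=
  (Ioo s t).biUnion fun s' => Ico (j s' - d) (j s')

theorem card_laterBlocks_le (t d : ℕ) (j : ℕ → ℕ) (s : ℕ) :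
    (laterBlocks t d j s).card ≤ t * d := by
  refine (card_biUnion_le_card_mul _ _ d fun s' _ => ?_).trans
    (Nat.mul_le_mul_right _ (by rw [Nat.card_Ioo]; omega))
  rw [Nat.card_Ico]; omega

/-- One time in each of `t` consecutive intervals, chosen from the last to the first so that the
blocks before the later times carry little information about the coordinate at the chosen one. -/
theorem exists_times [Nonempty Ω] [Fintype S] {κ₁ ε : ℝ} {t d q : ℕ} (ht : 0 < t) (hd : 0 < d)
    (hq : 0 < q) (hκ₁ : 0 ≤ κ₁) (hε : κ₁ / q ≤ ε)
    (hlow : ∀ e < t * (t * d * q + d), Real.log (Fintype.card S) - κ₁ ≤ blockRate Z e) :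
    ∃ j : ℕ → ℕ, ∀ s < t, s * (t * d * q + d) + d ≤ j s ∧ j s < (s + 1) * (t * d * q + d) ∧
      condEnt Z (j s) (Ico 0 (j s)) -
        condEnt Z (j s) (Ico 0 (j s) ∪ laterBlocks t d j s) ≤ ε := by
  set Q := t * d * q + d with hQ
  have hN : 0 < t * d * q := by positivity
  suffices H : ∀ r ≤ t, ∃ j : ℕ → ℕ, ∀ s, t - r ≤ s → s < t →
      s * Q + d ≤ j s ∧ j s < (s + 1) * Q ∧
      condEnt Z (j s) (Ico 0 (j s)) -
        condEnt Z (j s) (Ico 0 (j s) ∪ laterBlocks t d j s) ≤ ε by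
    obtain ⟨j, hj⟩ := H t le_rfl
    exact ⟨j, fun s hs => hj s (by omega) hs⟩
  intro r
  induction r with
  | zero => exact fun _ => ⟨id, fun s h1 h2 => by omega⟩
  | succ r ih =>
    intro hr
    obtain ⟨j, hj⟩ := ih (by omega)
    set s₀ := t - (r + 1) with hs₀
    have hΛ : ∀ k ∈ laterBlocks t d j s₀, s₀ * Q + d + t * d * q ≤ k ∧ k < t * Q := by
      intro k hk
      rw [laterBlocks, mem_biUnion] at hk
      obtain ⟨s', hs', hk⟩ := hk
      rw [mem_Ioo] at hs'
      rw [mem_Ico] at hk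
      obtain ⟨h1, h2, -⟩ := hj s' (by omega) hs'.2
      have h3 : (s₀ + 1) * Q ≤ s' * Q := Nat.mul_le_mul_right _ (by omega)
      have h4 : (s' + 1) * Q ≤ t * Q := Nat.mul_le_mul_right _ (by omega)
      rw [add_one_mul] at h3
      omega
    obtain ⟨i, hi1, hi2, hi⟩ := exists_condEnt_sub_le hN hlow _ hΛ
    refine ⟨Function.update j s₀ i, fun s hs hst => ?_⟩
    have hsame : ∀ s, s₀ ≤ s →
        laterBlocks t d (Function.update j s₀ i) s = laterBlocks t d j s := by
      intro s hs
      unfold laterBlocks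
      refine biUnion_congr rfl fun s' hs' => ?_
      rw [mem_Ioo] at hs'
      rw [Function.update_of_ne (by omega)]
    rw [hsame s (by omega)]
    rcases eq_or_ne s s₀ with rfl | hne
    · rw [Function.update_self]
      refine ⟨hi1, by rw [add_one_mul]; omega, hi.trans (le_trans ?_ hε)⟩
      have h5 : ((laterBlocks t d j s₀).card : ℝ) ≤ t * d := by
        exact_mod_cast card_laterBlocks_le t d j s₀
      have h6 : (0 : ℝ) < t * d := by positivity
      have h7 : (0 : ℝ) < q := Nat.cast_pos.2 hq
      calc _ ≤ (t * d * κ₁ : ℝ) / (t * d * q : ℕ) := by gcongr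
        _ = _ := by push_cast; field_simp
    · rw [Function.update_of_ne hne]
      exact hj s (by omega) hst

open Classical in
/-- Between the scales `d` and `t * (t * d * q + d)` the entropy rate must drop, for a stationary
process such that, given the coordinates strictly between them, distant coordinates have disjoint
supports. -/
theorem lt_blockRate_sub [Nonempty Ω] [Fintype S] (hst : Stationary Z) {κ₁ κ : ℝ} {t d q : ℕ}
    (hκ₁ : 0 ≤ κ₁) (hκ : κ = Real.exp (10 * (κ₁ + 1))) (ht : t = ⌈3 * κ⌉₊) (hd : 0 < d)
    (hq0 : 0 < q) (hq : κ₁ / q ≤ 1 / (10 ^ 6 * κ ^ 4))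
    (hlow : ∀ e < t * (t * d * q + d), Real.log (Fintype.card S) - κ₁ ≤ blockRate Z e)
    (hfree : ∀ i j, i + 2 ≤ j → j < t * (t * d * q + d) → ∀ ω ω',
      (∀ k ∈ Ico (i + 1) j, Z k ω = Z k ω') → Z i ω ≠ Z j ω') :
    1 / (10 ^ 6 * κ ^ 4) < blockRate Z d - blockRate Z (t * (t * d * q + d)) := by
  by_contra! hplat
  have hκ1 : 1 ≤ κ := by rw [hκ]; exact Real.one_le_exp (by linarith)
  have hκ0 : 0 < κ := by linarith
  have hlogκ : Real.log κ = 10 * (κ₁ + 1) := by rw [hκ, Real.log_exp]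
  have ht1 : 3 * κ ≤ t := by rw [ht]; exact Nat.le_ceil _
  have ht2 : (t : ℝ) ≤ 4 * κ := by
    rw [ht]; have := Nat.ceil_lt_add_one (by positivity : 0 ≤ 3 * κ); linarith
  have ht0 : 0 < t := by
    have : (0 : ℝ) < t := by linarith
    exact_mod_cast this
  have : Nonempty S := ⟨Z 0 (Classical.arbitrary Ω)⟩
  have hn : (0 : ℝ) < Fintype.card S := Nat.cast_pos.2 Fintype.card_pos
  have hN : (0 : ℝ) < Fintype.card Ω := Nat.cast_pos.2 Fintype.card_pos
  obtain ⟨j, hj⟩ := exists_times ht0 hd hq0 hκ₁ hq hlow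
  set Q := t * d * q + d with hQ
  set ε : ℝ := 1 / (10 ^ 6 * κ ^ 4) with hε
  set n : ℝ := (Fintype.card S : ℝ) with hndef
  set N : ℝ := (Fintype.card Ω : ℝ) with hNdef
  have hε1 : ε ≤ (1 / (500 * κ ^ 2)) ^ 2 / 4 := by
    rw [hε]; apply le_of_eq; field_simp; norm_num
  have hε2 : ε + ε ≤ (1 / 5) ^ 2 / 4 := by
    have : ε ≤ 1 / 10 ^ 6 := by
      rw [hε]
      apply one_div_le_one_div_of_le (by positivity)
      have : 1 ≤ κ ^ 4 := one_le_pow₀ hκ1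
      linarith
    linarith
  have hanti := hst.blockRate_antitone
  let L : ℕ → Finset ℕ := fun s => Ico (j s - d) (j s)
  let R : ℕ → Finset ℕ := fun s => Ico (j s + 1) (j s + 1 + d)
  have hjw : ∀ s < t, j s < t * Q := fun s hs =>
    (hj s hs).2.1.trans_le (Nat.mul_le_mul_right _ hs)
  have hsep : ∀ s s', s < s' → s' < t → j s + 1 + d ≤ j s' := by
    intro s s' h1 h2
    have h3 := (hj s (h1.trans h2)).2.1
    have h4 := (hj s' h2).1
    have h5 : (s + 1) * Q ≤ s' * Q := Nat.mul_le_mul_right _ h1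
    omega
  have hdj : ∀ s < t, d ≤ j s := fun s hs => by have := (hj s hs).1; omega
  have hcL : ∀ s < t, condEnt Z (j s) (L s) = blockRate Z d := fun s hs =>
    hst.condEnt_before (hdj s hs)
  have hcR : ∀ s, condEnt Z (j s) (R s) = blockRate Z d := fun s => hst.condEnt_after d (j s)
  have hdw : d < t * Q := (hdj 0 ht0).trans_lt (hjw 0 ht0)
  -- the values of large but bounded density under the law of `Z (j s)` given the block before it
  let A : ℕ → Ω → S → Prop := fun s ω v =>
    1 / 10 ≤ n * law Z (j s) (L s) ω v ∧ n * law Z (j s) (L s) ω v ≤ κ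
  obtain ⟨D, hD⟩ : ∃ D : ℕ → Ω → S → Prop,
      ∀ s ω v, D s ω v ↔ A s ω v ∧ ∀ s' ∈ Ioo s t, ¬ A s' ω v :=
    ⟨_, fun _ _ _ => Iff.rfl⟩
  -- the two conditional densities at `Z (j s)` are seldom above `κ`
  have htail : ∀ (i : ℕ) (I : Finset ℕ), condEnt Z i I = blockRate Z d →
      (∑ ω, if κ < n * law Z i I ω (Z i ω) then (1 : ℝ) else 0) ≤ 1 / 10 * N := by
    intro i I h
    have h1 := card_large_law_mul_log_le (Z := Z) (i := i) (I := I) hκ1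
    rw [h, hlogκ] at h1
    have h2 := hlow d hdw
    have h3 : (Real.log n - blockRate Z d + 1) * N ≤ (κ₁ + 1) * N := by gcongr; linarith
    have h4 := h1.trans h3
    refine le_of_mul_le_mul_right ?_ (by linarith : 0 < 10 * (κ₁ + 1))
    linarith
  have hover : ∀ s s', s < s' → s' < t →
      (∑ ω, if 1 / 10 ≤ n * law Z (j s') (L s') ω (Z (j s) ω) ∧
        n * law Z (j s) (R s) ω (Z (j s) ω) ≤ κ then (1 : ℝ) else 0) ≤ 11 / (500 * κ) * N := by
    intro s s' h1 h2
    have h3 := hsep s s' h1 h2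
    have h4 := hjw s' h2
    have hLs : L s' ⊆ Ico (j s + 1) (j s') := Ico_subset_Ico (by omega) le_rfl
    have hRs : R s ⊆ Ico (j s + 1) (j s') := Ico_subset_Ico le_rfl h3
    have e1 : condEnt Z (j s') (Ico (j s + 1) (j s')) = blockRate Z (j s' - (j s + 1)) := by
      rw [← hst.condEnt_before (i := j s') (by omega)]; congr 2; omega
    have e2 : condEnt Z (j s) (Ico (j s + 1) (j s')) = blockRate Z (j s' - (j s + 1)) := by
      rw [← hst.condEnt_after _ (j s)]; congr 2; omega
    have h5 : blockRate Z (t * Q) ≤ blockRate Z (j s' - (j s + 1)) := hanti (by omega)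
    have h6 := sum_overlap_le (Z := Z) (θ := 1 / 10) (κ := κ) (τ := 1 / (500 * κ ^ 2))
      (by norm_num) hκ0.le (by positivity) (hfree _ _ (by omega) h4) hLs hRs
      (by rw [hcL s' h2, e1]; linarith) (by rw [hcR, e2]; linarith)
    refine h6.trans ?_
    rw [← hNdef]
    gcongr
    calc (1 + κ / (1 / 10)) * (1 / (500 * κ ^ 2)) ≤ (11 * κ) * (1 / (500 * κ ^ 2)) := by
          gcongr; linarith
      _ = _ := by field_simp
  have hlower : ∀ s < t, 3 / 5 * N ≤ ∑ ω, if D s ω (Z (j s) ω) then (1 : ℝ) else 0 := by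
    intro s hs
    have h1 := htail (j s) (L s) (hcL s hs)
    have h2 := htail (j s) (R s) (hcR s)
    have h3 := card_small_law_le (Z := Z) (i := j s) (I := L s) (θ := 1 / 10) (by norm_num)
    have h4 : ∑ s' ∈ Ioo s t, (∑ ω, if 1 / 10 ≤ n * law Z (j s') (L s') ω (Z (j s) ω) ∧
        n * law Z (j s) (R s) ω (Z (j s) ω) ≤ κ then (1 : ℝ) else 0) ≤ 1 / 10 * N := by
      calc _ ≤ ∑ s' ∈ Ioo s t, 11 / (500 * κ) * N := sum_le_sum fun s' hs' => by
            rw [mem_Ioo] at hs'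
            exact hover s s' hs'.1 hs'.2
        _ = (Ioo s t).card * (11 / (500 * κ) * N) := by rw [sum_const, nsmul_eq_mul]
        _ ≤ (4 * κ) * (11 / (500 * κ) * N) := by
            gcongr
            refine le_trans ?_ ht2
            rw [Nat.card_Ioo]
            exact_mod_cast (by omega : t - s - 1 ≤ t)
        _ = 44 / 500 * N := by field_simp; norm_num
        _ ≤ _ := by linarith
    have h5 : N ≤ (∑ ω, if D s ω (Z (j s) ω) then (1 : ℝ) else 0) +
        (∑ ω, if n * law Z (j s) (L s) ω (Z (j s) ω) < 1 / 10 then (1 : ℝ) else 0) +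
        (∑ ω, if κ < n * law Z (j s) (L s) ω (Z (j s) ω) then (1 : ℝ) else 0) +
        (∑ ω, if κ < n * law Z (j s) (R s) ω (Z (j s) ω) then (1 : ℝ) else 0) +
        ∑ s' ∈ Ioo s t, (∑ ω, if 1 / 10 ≤ n * law Z (j s') (L s') ω (Z (j s) ω) ∧
          n * law Z (j s) (R s) ω (Z (j s) ω) ≤ κ then (1 : ℝ) else 0) := by
      rw [sum_comm (s := Ioo s t), ← sum_add_distrib, ← sum_add_distrib, ← sum_add_distrib,
        ← sum_add_distrib]
      have : N = ∑ _ω : Ω, (1 : ℝ) := by simp [hNdef]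
      rw [this]
      refine sum_le_sum fun ω _ => ?_
      have p : ∀ (P : Prop) [Decidable P], (0 : ℝ) ≤ if P then 1 else 0 := fun P _ => by
        split_ifs <;> norm_num
      have p5 : 0 ≤ ∑ s' ∈ Ioo s t, (if 1 / 10 ≤ n * law Z (j s') (L s') ω (Z (j s) ω) ∧
          n * law Z (j s) (R s) ω (Z (j s) ω) ≤ κ then (1 : ℝ) else 0) :=
        sum_nonneg fun _ _ => p _
      have p1 := p (D s ω (Z (j s) ω))
      have p2 := p (n * law Z (j s) (L s) ω (Z (j s) ω) < 1 / 10)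
      have p3 := p (κ < n * law Z (j s) (L s) ω (Z (j s) ω))
      have p4 := p (κ < n * law Z (j s) (R s) ω (Z (j s) ω))
      by_cases c1 : D s ω (Z (j s) ω)
      · rw [if_pos c1]; linarith
      by_cases c2 : n * law Z (j s) (L s) ω (Z (j s) ω) < 1 / 10
      · rw [if_pos c2]; linarith
      by_cases c3 : κ < n * law Z (j s) (L s) ω (Z (j s) ω)
      · rw [if_pos c3]; linarith
      by_cases c4 : κ < n * law Z (j s) (R s) ω (Z (j s) ω)
      · rw [if_pos c4]; linarith
      have c5 : ∃ s' ∈ Ioo s t, A s' ω (Z (j s) ω) := by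
        by_contra! h
        exact c1 <| (hD _ _ _).2 ⟨⟨not_lt.1 c2, not_lt.1 c3⟩, h⟩
      obtain ⟨s', hs', hA⟩ := c5
      have := single_le_sum (s := Ioo s t) (f := fun s' =>
        if 1 / 10 ≤ n * law Z (j s') (L s') ω (Z (j s) ω) ∧
          n * law Z (j s) (R s) ω (Z (j s) ω) ≤ κ then (1 : ℝ) else 0) (fun _ _ => p _) hs'
      rw [if_pos ⟨hA.1, not_lt.1 c4⟩] at this
      linarith
    linarith
  have hupper : ∀ s < t, (∑ ω, if D s ω (Z (j s) ω) then (1 : ℝ) else 0) ≤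
      1 / 5 * N + κ / n * ∑ ω, ∑ v, if D s ω v then (1 : ℝ) else 0 := by
    intro s hs
    obtain ⟨h1, h2, h3⟩ := hj s hs
    have hLG : ∀ s' ∈ Ico s t, L s' ⊆ Ico 0 (j s) ∪ laterBlocks t d j s := by
      intro s' hs'
      rw [mem_Ico] at hs'
      rcases hs'.1.eq_or_lt with rfl | hlt
      · exact (Ico_subset_Ico (Nat.zero_le _) le_rfl).trans subset_union_left
      · refine subset_trans ?_ subset_union_right
        exact subset_biUnion_of_mem (fun s' => Ico (j s' - d) (j s')) (mem_Ioo.2 ⟨hlt, hs'.2⟩)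
    have hs_mem : s ∈ Ico s t := mem_Ico.2 ⟨le_rfl, hs⟩
    refine sum_mem_le (τ := 1 / 5) (by norm_num) (hLG s hs_mem) ?_ (D s) ?_
      fun ω v h => ((hD _ _ _).1 h).1.2
    · have h4 : blockRate Z (t * Q) ≤ condEnt Z (j s) (Ico 0 (j s)) := hanti (hjw s hs).le
      rw [hcL s hs]
      linarith
    · intro ω ω' hω
      have hA : ∀ s' ∈ Ico s t, A s' ω' = A s' ω := fun s' hs' => by
        funext v
        simp only [A, law_congr (hLG s' hs') hω]
      funext v
      simp only [hD, hA s hs_mem, eq_iff_iff, and_congr_right_iff]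
      intro _
      refine forall₂_congr fun s' hs' => ?_
      rw [hA s' (mem_Ico.2 ⟨(mem_Ioo.1 hs').1.le, (mem_Ioo.1 hs').2⟩)]
  have hdisj : ∑ s ∈ range t, ∑ ω, ∑ v, (if D s ω v then (1 : ℝ) else 0) ≤ n * N := by
    rw [sum_comm]
    calc _ ≤ ∑ _ω : Ω, n := by
          refine sum_le_sum fun ω _ => ?_
          rw [sum_comm]
          calc _ ≤ ∑ _v : S, (1 : ℝ) := by
                refine sum_le_sum fun v _ => ?_
                rw [sum_boole]
                have : ((range t).filter fun s => D s ω v).card ≤ 1 := by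
                  rw [card_le_one]
                  intro a ha b hb
                  rw [mem_filter, mem_range, hD] at ha hb
                  rcases lt_trichotomy a b with h | h | h
                  · exact absurd hb.2.1 (ha.2.2 b (mem_Ioo.2 ⟨h, hb.1⟩))
                  · exact h
                  · exact absurd ha.2.1 (hb.2.2 a (mem_Ioo.2 ⟨h, ha.1⟩))
                exact_mod_cast this
            _ = n := by simp [hndef]
      _ = n * N := by simp [hNdef, mul_comm]
  have hfin : ∑ s ∈ range t, 3 / 5 * N ≤ ∑ s ∈ range t, (1 / 5 * N +
      κ / n * ∑ ω, ∑ v, if D s ω v then (1 : ℝ) else 0) :=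
    sum_le_sum fun s hs => (hlower s (mem_range.1 hs)).trans (hupper s (mem_range.1 hs))
  rw [sum_add_distrib, sum_const, sum_const, card_range, nsmul_eq_mul,
    nsmul_eq_mul] at hfin
  have h7 : κ / n * ∑ s ∈ range t, ∑ ω, ∑ v, (if D s ω v then (1 : ℝ) else 0) ≤ κ * N := by
    calc _ ≤ κ / n * (n * N) := by gcongr
      _ = κ * N := by field_simp
  rw [mul_sum] at h7
  have h8 : 3 * κ * N ≤ t * N := by gcongr
  have h9 : 0 < κ * N := by positivity
  linarith

end CoordEntropy

namespace CoordEntropy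

open Finset

variable {Ω S : Type*} [Fintype Ω] {Z : ℕ → Ω → S}

/-- A stationary process with alphabet `S` and entropy rate at least `log |S| - κ₁`, in which
distant coordinates have disjoint supports given the coordinates between them, is short. -/
theorem lt_exp_exp_of_le_blockRate [Nonempty Ω] [Fintype S] (hst : Stationary Z) {κ₁ : ℝ} {m : ℕ}
    (hκ₁ : 0 ≤ κ₁) (hlow : ∀ e ≤ m, Real.log (Fintype.card S) - κ₁ ≤ blockRate Z e)
    (hfree : ∀ i j, i + 2 ≤ j → j ≤ m → ∀ ω ω',
      (∀ k ∈ Ico (i + 1) j, Z k ω = Z k ω') → Z i ω ≠ Z j ω') :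
    (m : ℝ) < Real.exp (Real.exp (90 * (κ₁ + 1))) := by
  by_contra! hm
  set κ := Real.exp (10 * (κ₁ + 1)) with hκ
  have hκ1 : 1024 ≤ κ := by
    have h1 : (2 : ℝ) ≤ Real.exp 1 := by
      have := Real.add_one_le_exp (1 : ℝ); linarith
    calc (1024 : ℝ) = 2 ^ 10 := by norm_num
      _ ≤ Real.exp 1 ^ 10 := by gcongr
      _ = Real.exp 10 := by rw [← Real.exp_nat_mul]; norm_num
      _ ≤ κ := Real.exp_le_exp.2 (by linarith)
  have hκκ : κ₁ ≤ κ := by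
    have := Real.add_one_le_exp (10 * (κ₁ + 1)); linarith
  have hκ0 : 0 < κ := by linarith
  set t := ⌈3 * κ⌉₊ with ht
  set q := ⌈κ₁ * (10 ^ 6 * κ ^ 4)⌉₊ + 1 with hq
  have hq0 : 0 < q := Nat.succ_pos _
  have hqR : (0 : ℝ) < q := Nat.cast_pos.2 hq0
  have ht2 : (t : ℝ) ≤ 4 * κ := by
    have := Nat.ceil_lt_add_one (by positivity : 0 ≤ 3 * κ); linarith
  have ht0 : 0 < t := Nat.ceil_pos.2 (by positivity)
  have hqle : κ₁ * (10 ^ 6 * κ ^ 4) ≤ q := by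
    have := Nat.le_ceil (κ₁ * (10 ^ 6 * κ ^ 4)); rw [hq]; push_cast; linarith
  have hqε : κ₁ / q ≤ 1 / (10 ^ 6 * κ ^ 4) := by
    rw [div_le_div_iff₀ hqR (by positivity), one_mul]; exact hqle
  have hq2 : (q : ℝ) ≤ 2 * κ ^ 7 := by
    have h1 := Nat.ceil_lt_add_one (by positivity : 0 ≤ κ₁ * (10 ^ 6 * κ ^ 4))
    have h2 : κ₁ * (10 ^ 6 * κ ^ 4) ≤ κ * (κ ^ 2 * κ ^ 4) := by
      gcongr; nlinarith
    have h3 : (1 : ℝ) ≤ κ ^ 6 := one_le_pow₀ (by linarith)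
    have h4 : κ ^ 7 = κ * κ ^ 6 := by ring
    rw [hq]; push_cast
    nlinarith
  set ρ := t * (t * q + 1) with hρ
  have hρ1 : 0 < ρ := by positivity
  have hρ2 : (ρ : ℝ) ≤ κ ^ 10 := by
    rw [hρ]; push_cast
    have h8 : (1 : ℝ) ≤ κ ^ 8 := one_le_pow₀ (by linarith)
    calc (t : ℝ) * (t * q + 1) ≤ 4 * κ * (4 * κ * (2 * κ ^ 7) + κ ^ 8) := by gcongr
      _ = 36 * κ ^ 9 := by ring
      _ ≤ κ * κ ^ 9 := by gcongr; linarith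
      _ = κ ^ 10 := by ring
  have hρq : ρ ^ q ≤ m := by
    have h1 : (ρ : ℝ) ^ q ≤ m := by
      refine le_trans ?_ hm
      have h2 : κ ≤ Real.exp κ := by have := Real.add_one_le_exp κ; linarith
      calc (ρ : ℝ) ^ q ≤ (Real.exp κ ^ 10) ^ q := by
            gcongr; exact hρ2.trans (by gcongr)
        _ = Real.exp (q * (10 * κ)) := by
            rw [← Real.exp_nat_mul, ← Real.exp_nat_mul]; norm_num
        _ ≤ Real.exp (Real.exp (90 * (κ₁ + 1))) := by
            apply Real.exp_le_exp.2
            have h3 : Real.exp (90 * (κ₁ + 1)) = κ ^ 9 := by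
              rw [hκ, ← Real.exp_nat_mul]; congr 1; push_cast; ring
            rw [h3]
            calc q * (10 * κ) ≤ 2 * κ ^ 7 * (10 * κ) := by gcongr
              _ = 20 * κ ^ 8 := by ring
              _ ≤ κ * κ ^ 8 := by gcongr; linarith
              _ = κ ^ 9 := by ring
    exact_mod_cast h1
  -- the entropy rate drops between any two consecutive scales
  have hdrop : ∀ k ∈ range q, κ₁ / q < blockRate Z (ρ ^ k) - blockRate Z (ρ ^ (k + 1)) := by
    intro k hk
    rw [mem_range] at hk
    have h1 : t * (t * ρ ^ k * q + ρ ^ k) = ρ ^ (k + 1) := by rw [hρ, pow_succ]; ring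
    have h2 : ρ ^ (k + 1) ≤ m := (Nat.pow_le_pow_right hρ1 hk).trans hρq
    have h3 := lt_blockRate_sub hst (d := ρ ^ k) hκ₁ hκ ht (by positivity) hq0 hqε
      (by rw [h1]; exact fun e he => hlow e (he.le.trans h2))
      (by rw [h1]; exact fun i j hij hj => hfree i j hij (hj.le.trans h2))
    rw [h1] at h3
    exact hqε.trans_lt h3
  have h1 := sum_lt_sum_of_nonempty (nonempty_range_iff.2 hq0.ne') hdrop
  rw [sum_range_sub', sum_const, card_range, nsmul_eq_mul, mul_div_cancel₀ _ hqR.ne'] at h1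
  have h2 : blockRate Z (ρ ^ 0) ≤ Real.log (Fintype.card S) := condEnt_le_log
  have h3 := hlow _ hρq
  linarith

theorem stationary_of_perm (T : Equiv.Perm Ω) (hT : ∀ l ω, Z l (T ω) = Z (l + 1) ω) :
    Stationary Z := by
  intro a b
  unfold ent
  congr 1
  rw [← Equiv.sum_comp T fun ω => Real.log (Fintype.card Ω / (cell Z (Ico a b) ω).card)]
  refine sum_congr rfl fun ω _ => ?_
  congr 3
  refine card_bij (fun x _ => T x) (fun x hx => ?_) (fun x _ y _ h => T.injective h)
    fun y hy => ⟨T.symm y, ?_, by simp⟩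
  · rw [mem_cell] at hx ⊢
    intro k hk
    rw [hT, hT]
    rw [mem_Ico] at hk
    exact hx (k + 1) (mem_Ico.2 (by omega))
  · rw [mem_cell] at hy ⊢
    intro k hk
    rw [mem_Ico] at hk
    obtain ⟨k, rfl⟩ : ∃ k', k = k' + 1 := ⟨k - 1, by omega⟩
    rw [← hT, ← hT, Equiv.apply_symm_apply]
    exact hy k (mem_Ico.2 (by omega))

theorem ent_eq_log_card {I : Finset ℕ} (h : ∀ ω ω', (∀ k ∈ I, Z k ω' = Z k ω) → ω' = ω)
    [Nonempty Ω] : ent Z I = Real.log (Fintype.card Ω) := by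
  have hN : (0 : ℝ) < Fintype.card Ω := Nat.cast_pos.2 Fintype.card_pos
  have h1 : ∀ ω, cell Z I ω = {ω} := fun ω => by
    ext x
    rw [mem_cell, mem_singleton]
    exact ⟨h ω x, fun hx _ _ => by rw [hx]⟩
  simp [ent, h1, card_univ, hN.ne']

theorem Stationary.ent_le [Nonempty Ω] [Fintype S] (hst : Stationary Z) {d M : ℕ} (h : d ≤ M) :
    ent Z (Ico 0 M) ≤ d * Real.log (Fintype.card S) + (M - d) * blockRate Z d := by
  induction M, h using Nat.le_induction with
  | base =>
    have := ent_union_le (Z := Z) ∅ (Ico 0 d)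
    rw [empty_union, ent_empty, Nat.card_Ico] at this
    simpa using this
  | succ M hM ih =>
    have h1 := blockRate_eq Z M
    have h2 := hst.blockRate_antitone hM
    push_cast
    linarith

end CoordEntropy

/-! ### Rectangles of Hamiltonian pairs of permutations -/

namespace PointerChasing

open Finset CoordEntropy

variable {α : Type*}

/-- The two permutations `a` and `b`, which map between two copies of `α` in opposite directions,
combined into one permutation of the disjoint union of the copies. -/
def alternate (a b : Equiv.Perm α) : Equiv.Perm (α ⊕ α) :=
  (Equiv.sumCongr a b).trans (Equiv.sumComm α α)

@[simp] theorem alternate_inl (a b : Equiv.Perm α) (x : α) :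
    alternate a b (Sum.inl x) = Sum.inr (a x) := rfl

@[simp] theorem alternate_inr (a b : Equiv.Perm α) (x : α) :
    alternate a b (Sum.inr x) = Sum.inl (b x) := rfl

/-- The alternating walk of a random pair in `A × B` from a random start. -/
def walkProcess (A B : Finset (Equiv.Perm α)) (l : ℕ) (ω : A × B × (α ⊕ α)) : α ⊕ α :=
  (alternate ω.1.1 ω.2.1.1 ^ l) ω.2.2

theorem walkProcess_succ (A B : Finset (Equiv.Perm α)) (l : ℕ) (ω : A × B × (α ⊕ α)) :
    walkProcess A B (l + 1) ω = alternate ω.1.1 ω.2.1.1 (walkProcess A B l ω) := by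
  rw [walkProcess, pow_succ', Equiv.Perm.mul_apply]; rfl

/-- The union of `a` and `b`, seen as perfect matchings between two copies of `α`, is a Hamiltonian
cycle: no walk that alternates between `a` and `b` returns early. -/
def Hamiltonian [Fintype α] (a b : Equiv.Perm α) : Prop :=
  ∀ v, ∀ l, 0 < l → l < 2 * Fintype.card α → (alternate a b ^ l) v ≠ v

variable [Fintype α]

theorem stationary_walkProcess (A B : Finset (Equiv.Perm α)) :
    Stationary (walkProcess A B) := by
  refine stationary_of_perm (Equiv.prodShear (Equiv.refl A)
    fun a => Equiv.prodShear (Equiv.refl B) fun b => alternate a.1 b.1) fun l ω => ?_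
  rw [walkProcess, walkProcess, pow_succ, Equiv.Perm.mul_apply]
  rfl

theorem Hamiltonian.pow_injective {a b : Equiv.Perm α} (h : Hamiltonian a b) (v : α ⊕ α)
    {k l : ℕ} (hk : k < 2 * Fintype.card α) (hl : l < 2 * Fintype.card α)
    (he : (alternate a b ^ k) v = (alternate a b ^ l) v) : k = l := by
  wlog hkl : k ≤ l generalizing k l
  · exact (this hl hk he.symm (by omega)).symm
  by_contra hne
  obtain ⟨d, rfl⟩ := Nat.exists_eq_add_of_le hkl
  rw [pow_add, Equiv.Perm.mul_apply] at he
  exact h v d (by omega) (by omega) ((alternate a b ^ k).injective he).symm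

/-- On a rectangle of Hamiltonian pairs, a walk of one pair and a walk of another that agree
between the times `i` and `j` do not occupy the same vertex at the times `i` and `j`: otherwise
the first player's permutation of one pair and the second player's of the other would close a
short cycle. -/
theorem walkProcess_ne {A B : Finset (Equiv.Perm α)} (h : ∀ a ∈ A, ∀ b ∈ B, Hamiltonian a b)
    {i j : ℕ} (hij : i + 2 ≤ j) (hj : j < 2 * Fintype.card α) (ω ω' : A × B × (α ⊕ α))
    (hagree : ∀ k ∈ Ico (i + 1) j, walkProcess A B k ω = walkProcess A B k ω') :
    walkProcess A B i ω ≠ walkProcess A B j ω' := by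
  intro heq
  -- `p` follows the first walk out of the common vertex and the second walk back into it
  have key : ∀ p : Equiv.Perm (α ⊕ α),
      (∀ v l, 0 < l → l < 2 * Fintype.card α → (p ^ l) v ≠ v) →
      p (walkProcess A B i ω) = walkProcess A B (i + 1) ω →
      (∀ k, i + 1 ≤ k → k + 1 < j → p (walkProcess A B k ω) = walkProcess A B (k + 1) ω) →
      p (walkProcess A B (j - 1) ω') = walkProcess A B j ω' → False := by
    intro p hp h1 h2 h3
    have h4 : ∀ d, i + 1 + d < j → (p ^ (d + 1)) (walkProcess A B i ω) =
        walkProcess A B (i + 1 + d) ω := by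
      intro d
      induction d with
      | zero => intro _; simpa using h1
      | succ d ih =>
        intro hd
        rw [pow_succ', Equiv.Perm.mul_apply, ih (by omega), h2 _ (by omega) (by omega)]
        rfl
    have h5 := h4 (j - 1 - (i + 1)) (by omega)
    have h6 : i + 1 + (j - 1 - (i + 1)) = j - 1 := by omega
    rw [h6, hagree (j - 1) (mem_Ico.2 (by omega))] at h5
    refine hp (walkProcess A B i ω) (j - 1 - (i + 1) + 1 + 1) (by omega) (by omega) ?_
    rw [pow_succ', Equiv.Perm.mul_apply, h5, h3, heq]
  obtain ⟨⟨a, ha⟩, ⟨b, hb⟩, v⟩ := ω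
  obtain ⟨⟨a', ha'⟩, ⟨b', hb'⟩, v'⟩ := ω'
  set ω : A × B × (α ⊕ α) := (⟨a, ha⟩, ⟨b, hb⟩, v) with hω
  set ω' : A × B × (α ⊕ α) := (⟨a', ha'⟩, ⟨b', hb'⟩, v') with hω'
  have hs : ∀ k, walkProcess A B (k + 1) ω = alternate a b (walkProcess A B k ω) :=
    fun k => walkProcess_succ A B k ω
  have hs' : ∀ k, walkProcess A B (k + 1) ω' = alternate a' b' (walkProcess A B k ω') :=
    fun k => walkProcess_succ A B k ω'
  have hlast : alternate a' b' (walkProcess A B (j - 1) ω') = walkProcess A B j ω' := by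
    rw [← hs']; congr 1; omega
  have hmid : ∀ k, i + 1 ≤ k → k + 1 < j →
      alternate a b (walkProcess A B k ω) = walkProcess A B (k + 1) ω ∧
      alternate a' b' (walkProcess A B k ω) = walkProcess A B (k + 1) ω := by
    intro k h1 h2
    refine ⟨(hs k).symm, ?_⟩
    rw [hagree k (mem_Ico.2 (by omega)), hagree (k + 1) (mem_Ico.2 (by omega)), hs']
  rcases hv : walkProcess A B i ω with x | y
  · refine key (alternate a b') (h a ha b' hb') ?_ ?_ ?_
    · rw [hs, hv]; rfl
    · intro k h1 h2
      obtain ⟨h3, h4⟩ := hmid k h1 h2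
      rcases hk : walkProcess A B k ω with x' | y' <;> rw [hk] at h3 h4
      · exact h3
      · exact h4
    · rw [← heq, hv] at hlast ⊢
      rcases hk : walkProcess A B (j - 1) ω' with x' | y' <;> rw [hk] at hlast
      · simp at hlast
      · exact hlast
  · refine key (alternate a' b) (h a' ha' b hb) ?_ ?_ ?_
    · rw [hs, hv]; rfl
    · intro k h1 h2
      obtain ⟨h3, h4⟩ := hmid k h1 h2
      rcases hk : walkProcess A B k ω with x' | y' <;> rw [hk] at h3 h4
      · exact h4
      · exact h3
    · rw [← heq, hv] at hlast ⊢
      rcases hk : walkProcess A B (j - 1) ω' with x' | y' <;> rw [hk] at hlast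
      · exact hlast
      · simp at hlast

/-- A full turn of the alternating walk determines both permutations and the start. -/
theorem eq_of_walkProcess_eq {A B : Finset (Equiv.Perm α)}
    (h : ∀ a ∈ A, ∀ b ∈ B, Hamiltonian a b) (ω ω' : A × B × (α ⊕ α))
    (hagree : ∀ k ∈ Ico 0 (2 * Fintype.card α + 1),
      walkProcess A B k ω' = walkProcess A B k ω) : ω' = ω := by
  classical
  have hH := h _ ω.1.2 _ ω.2.1.2
  have hcover : ∀ v, ∃ k < 2 * Fintype.card α, walkProcess A B k ω = v := by
    have hinj : Function.Injective fun k : Fin (2 * Fintype.card α) => walkProcess A B k ω :=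
      fun k l hkl => Fin.ext (hH.pow_injective _ k.2 l.2 hkl)
    have hbij := (Fintype.bijective_iff_injective_and_card _).2
      ⟨hinj, by rw [Fintype.card_fin, Fintype.card_sum]; omega⟩
    intro v
    obtain ⟨k, hk⟩ := hbij.2 v
    exact ⟨k, k.2, hk⟩
  have hp : ∀ v, alternate ω'.1.1 ω'.2.1.1 v = alternate ω.1.1 ω.2.1.1 v := by
    intro v
    obtain ⟨k, hk, rfl⟩ := hcover v
    rw [← walkProcess_succ, ← hagree k (mem_Ico.2 (by omega)), ← walkProcess_succ]
    exact hagree (k + 1) (mem_Ico.2 (by omega))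
  have h0 := hagree 0 (mem_Ico.2 (by omega))
  obtain ⟨⟨a, ha⟩, ⟨b, hb⟩, v⟩ := ω
  obtain ⟨⟨a', ha'⟩, ⟨b', hb'⟩, v'⟩ := ω'
  have e1 : a' = a := Equiv.ext fun x => Sum.inr_injective (hp (Sum.inl x))
  have e2 : b' = b := Equiv.ext fun x => Sum.inl_injective (hp (Sum.inr x))
  have e3 : v' = v := h0
  subst e1 e2 e3
  rfl

theorem mul_log_sub_le_log_factorial (m : ℕ) (hm : 0 < m) :
    m * Real.log m - m ≤ Real.log (m.factorial) := by
  have hm' : (0 : ℝ) < m := Nat.cast_pos.2 hm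
  have hf : (0 : ℝ) < m.factorial := Nat.cast_pos.2 m.factorial_pos
  have h1 := Real.pow_div_factorial_le_exp (m : ℝ) hm'.le m
  have h2 := Real.log_le_log (by positivity) h1
  rw [Real.log_exp, Real.log_div (by positivity) hf.ne', Real.log_pow] at h2
  linarith

/-- A rectangle of pairs of permutations whose unions are all Hamiltonian is small. -/
theorem card_mul_card_le_of_hamiltonian {A B : Finset (Equiv.Perm α)}
    (h : ∀ a ∈ A, ∀ b ∈ B, Hamiltonian a b)
    (hm : Real.exp (Real.exp 900) ≤ Fintype.card α) :
    (A.card : ℝ) * B.card ≤ (Fintype.card α).factorial ^ 2 *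
      Real.exp (-(1 / 180 * (Fintype.card α * Real.log (Real.log (Fintype.card α))))) := by
  by_contra! hlt
  set m := Fintype.card α with hmdef
  have hmR : (0 : ℝ) < m := (Real.exp_pos _).trans_le hm
  have hm0 : 0 < m := Nat.cast_pos.1 hmR
  set LL := Real.log (Real.log m) with hLL
  have hlog : Real.exp 900 ≤ Real.log m := by
    rw [← Real.log_exp (Real.exp 900)]; exact Real.log_le_log (Real.exp_pos _) hm
  have hlogpos : 0 < Real.log m := (Real.exp_pos _).trans_le hlog
  have hLL900 : 900 ≤ LL := by
    rw [← Real.log_exp 900]; exact Real.log_le_log (Real.exp_pos _) hlog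
  have hABpos : (0 : ℝ) < (A.card : ℝ) * B.card := lt_of_le_of_lt (by positivity) hlt
  have hApos : (0 : ℝ) < A.card := pos_of_mul_pos_left hABpos (by positivity)
  have hBpos : (0 : ℝ) < B.card := pos_of_mul_pos_right hABpos (by positivity)
  obtain ⟨a₀, ha₀⟩ := card_pos.1 (Nat.cast_pos.1 hApos)
  obtain ⟨b₀, hb₀⟩ := card_pos.1 (Nat.cast_pos.1 hBpos)
  have hα : Nonempty α := Fintype.card_pos_iff.1 hm0
  have : Nonempty (A × B × (α ⊕ α)) := ⟨⟨a₀, ha₀⟩, ⟨b₀, hb₀⟩, Sum.inl hα.some⟩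
  set Z := walkProcess A B
  have hst : Stationary Z := stationary_walkProcess A B
  have hcard : Fintype.card (α ⊕ α) = 2 * m := by rw [Fintype.card_sum, two_mul]
  have hlogn : Real.log (Fintype.card (α ⊕ α)) = Real.log 2 + Real.log m := by
    rw [hcard]; push_cast; rw [Real.log_mul two_ne_zero hmR.ne']
  have hent : ent Z (Ico 0 (2 * m + 1)) =
      Real.log (A.card * B.card) + Real.log (Fintype.card (α ⊕ α)) := by
    rw [ent_eq_log_card (eq_of_walkProcess_eq h), Fintype.card_prod, Fintype.card_prod,
      Fintype.card_coe, Fintype.card_coe, ← Real.log_mul hABpos.ne']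
    · push_cast; rw [mul_assoc]
    · rw [hcard]; positivity
  have hlogAB : 2 * (m * Real.log m - m) - 1 / 180 * (m * LL) ≤ Real.log (A.card * B.card) := by
    have h1 := Real.log_le_log (by positivity) hlt.le
    rw [Real.log_mul (by positivity) (Real.exp_pos _).ne', Real.log_exp, Real.log_pow] at h1
    have h2 := mul_log_sub_le_log_factorial m hm0
    push_cast at h1
    linarith
  have hlow : ∀ e ≤ m, Real.log (Fintype.card (α ⊕ α)) - (4 + 1 / 180 * LL) ≤ blockRate Z e := by
    intro e he
    have h1 := hst.ent_le (d := e) (M := 2 * m + 1) (by omega)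
    rw [hent] at h1
    have h2 : blockRate Z e ≤ Real.log (Fintype.card (α ⊕ α)) := condEnt_le_log
    have he' : (e : ℝ) ≤ m := Nat.cast_le.2 he
    have h3 := Real.log_two_lt_d9
    set x := Real.log (Fintype.card (α ⊕ α)) - blockRate Z e with hx
    have hx0 : 0 ≤ x := by linarith
    have h4 : m * x ≤ m * (4 + 1 / 180 * LL) := by
      have h5 : (m : ℝ) * x ≤ (2 * m + 1 - e) * x := by gcongr; linarith
      push_cast at h1
      have h6 : blockRate Z e = Real.log (Fintype.card (α ⊕ α)) - x := by rw [hx]; ring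
      rw [h6] at h1
      rw [hlogn] at h1
      nlinarith
    have := le_of_mul_le_mul_left h4 hmR
    linarith
  have hfin := lt_exp_exp_of_le_blockRate hst (m := m) (by positivity) hlow
    fun i j hij hj ω ω' => walkProcess_ne h hij (by omega) ω ω'
  have h1 : Real.exp (Real.exp (90 * (4 + 1 / 180 * LL + 1))) ≤ m := by
    calc _ ≤ Real.exp (Real.exp LL) :=
          Real.exp_le_exp.2 (Real.exp_le_exp.2 (by linarith))
      _ = m := by rw [hLL, Real.exp_log hlogpos, Real.exp_log hmR]
  linarith

end PointerChasing

/-! ### Protocols and rectangles -/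

namespace PointerChasing

open Finset

open Classical in
/-- Kraft's inequality for protocols: at a leaf the output is a function of one player's input, so
that the inputs of value `v` that reach the leaf form a rectangle. If all such rectangles have at
most `M` elements, the weights `2 ^ (-cost)` of the inputs of value `v` sum to at most `M`. -/
theorem ProtocolTree.sum_pow_cost_le {p : Player} {X Y X' Y' : Type} (eA : X' → X) (eB : Y' → Y)
    {H : X' → Y' → Prop} {v : Bool} {M : ℝ}
    (hM : ∀ (A : Finset X') (B : Finset Y'), (∀ a ∈ A, ∀ b ∈ B, H a b) →
      (A.card : ℝ) * B.card ≤ M)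
    (τ : ProtocolTree p X Y Bool) (A : Finset X') (B : Finset Y')
    (hτ : ∀ a ∈ A, ∀ b ∈ B, (τ.output (eA a) (eB b) = v ↔ H a b)) :
    ∑ a ∈ A, ∑ b ∈ B, (if H a b then (1 / 2 : ℝ) ^ τ.cost (eA a) (eB b) else 0) ≤ M := by
  induction τ generalizing A B with
  | leaf out =>
    simp only [cost, pow_zero]
    cases p with
    | alice =>
      refine le_trans (le_of_eq ?_) (hM (A.filter fun a => out (eA a) = v) B fun a ha b hb =>
        (hτ a (mem_filter.1 ha).1 b hb).1 (mem_filter.1 ha).2)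
      rw [card_filter, Nat.cast_sum, sum_mul]
      refine sum_congr rfl fun a ha => ?_
      have h1 : ∀ b ∈ B, (if H a b then (1 : ℝ) else 0) = if out (eA a) = v then 1 else 0 :=
        fun b hb => if_congr (hτ a ha b hb).symm rfl rfl
      rw [sum_congr rfl h1, sum_const, nsmul_eq_mul]
      push_cast
      ring
    | bob =>
      refine le_trans (le_of_eq ?_) (hM A (B.filter fun b => out (eB b) = v) fun a ha b hb =>
        (hτ a ha b (mem_filter.1 hb).1).1 (mem_filter.1 hb).2)
      rw [card_filter, Nat.cast_sum, mul_sum, sum_comm]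
      refine sum_congr rfl fun b hb => ?_
      have h1 : ∀ a ∈ A, (if H a b then (1 : ℝ) else 0) = if out (eB b) = v then 1 else 0 :=
        fun a ha => if_congr (hτ a ha b hb).symm rfl rfl
      rw [sum_congr rfl h1, sum_const, nsmul_eq_mul]
      push_cast
      ring
  | aliceSends bit next ih =>
    have h1 : ∀ c : Bool, ∑ a ∈ A.filter (fun a => bit (eA a) = c), ∑ b ∈ B,
        (if H a b then (1 / 2 : ℝ) ^ (aliceSends bit next).cost (eA a) (eB b) else 0) ≤ M / 2 := by
      intro c
      have h2 := ih c (A.filter fun a => bit (eA a) = c) B fun a ha b hb => by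
        rw [← hτ a (mem_filter.1 ha).1 b hb, ← (mem_filter.1 ha).2]; rfl
      refine le_trans (le_of_eq ?_) (div_le_div_of_nonneg_right h2 zero_le_two)
      rw [sum_div]
      refine sum_congr rfl fun a ha => ?_
      rw [sum_div]
      refine sum_congr rfl fun b _ => ?_
      rw [cost, (mem_filter.1 ha).2]
      split_ifs
      · rw [pow_succ]; ring
      · simp
    rw [← sum_fiberwise A fun a => bit (eA a), Fintype.sum_bool]
    linarith [h1 true, h1 false]
  | bobSends bit next ih =>
    have h1 : ∀ c : Bool, ∑ b ∈ B.filter (fun b => bit (eB b) = c), ∑ a ∈ A,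
        (if H a b then (1 / 2 : ℝ) ^ (bobSends bit next).cost (eA a) (eB b) else 0) ≤ M / 2 := by
      intro c
      have h2 := ih c A (B.filter fun b => bit (eB b) = c) fun a ha b hb => by
        rw [← hτ a ha b (mem_filter.1 hb).1, ← (mem_filter.1 hb).2]; rfl
      refine le_trans (le_of_eq ?_) (div_le_div_of_nonneg_right h2 zero_le_two)
      rw [sum_comm, sum_div]
      refine sum_congr rfl fun a _ => ?_
      rw [sum_div]
      refine sum_congr rfl fun b hb => ?_
      rw [cost, (mem_filter.1 hb).2]
      split_ifs
      · rw [pow_succ]; ring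
      · simp
    rw [sum_comm, ← sum_fiberwise B fun b => bit (eB b), Fintype.sum_bool]
    linarith [h1 true, h1 false]

/-- Jensen's inequality for the convex function `x ↦ 2 ^ (-x)`: a sum of the weights
`2 ^ (-c i)` of at most `M` forces a large average of `c`. -/
theorem card_mul_log_le_sum {ι : Type*} (s : Finset ι) (c : ι → ℕ) {M : ℝ} (hM : 0 < M)
    (hs : 0 < s.card) (h : ∑ i ∈ s, (1 / 2 : ℝ) ^ c i ≤ M) :
    s.card * Real.log (s.card / M) ≤ ∑ i ∈ s, (c i : ℝ) := by
  have hsR : (0 : ℝ) < s.card := Nat.cast_pos.2 hs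
  set l := Real.log (s.card / M) with hl
  have hexp : Real.exp (-l) = M / s.card := by
    rw [Real.exp_neg, hl, Real.exp_log (by positivity), inv_div]
  have hpt : ∀ i ∈ s, M / s.card * (1 + l - c i) ≤ (1 / 2 : ℝ) ^ c i := by
    intro i _
    calc M / s.card * (1 + l - c i) ≤ M / s.card * Real.exp (l - c i) := by
          gcongr
          have := Real.add_one_le_exp (l - c i)
          linarith
      _ = Real.exp (-1) ^ c i := by
          rw [← hexp, ← Real.exp_add, ← Real.exp_nat_mul]; congr 1; ring
      _ ≤ (1 / 2 : ℝ) ^ c i := by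
          have h2 : (2 : ℝ) ≤ Real.exp 1 := by
            have := Real.add_one_le_exp (1 : ℝ); linarith
          have : Real.exp (-1) ≤ 1 / 2 := by
            rw [Real.exp_neg, ← one_div]; exact one_div_le_one_div_of_le two_pos h2
          gcongr
  have h1 := (sum_le_sum hpt).trans h
  rw [← mul_sum, sum_sub_distrib, sum_const, nsmul_eq_mul, div_mul_eq_mul_div,
    div_le_iff₀ hsR] at h1
  have h2 := le_of_mul_le_mul_left h1 hM
  linarith

instance : IsProbabilityMeasure coinMeasure := by
  unfold coinMeasure
  have : IsProbabilityMeasure (PMF.uniformOfFintype Bool).toMeasure :=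
    PMF.toMeasure.isProbabilityMeasure _
  infer_instance

open Classical in
/-- The rectangle bound for zero-error protocols: averaged over the embedded inputs of value `v`,
the cost is at least the logarithm of their number divided by the size `M` of the largest rectangle
of such inputs. -/
theorem le_zeroErrorCC {X Y X' Y' : Type} [Fintype X'] [Fintype Y'] (F : X → Y → Bool)
    (eA : X' → X) (eB : Y' → Y) {H : X' → Y' → Prop} {v : Bool} {M : ℝ} (hM0 : 0 < M)
    (hM : ∀ (A : Finset X') (B : Finset Y'), (∀ a ∈ A, ∀ b ∈ B, H a b) →
      (A.card : ℝ) * B.card ≤ M)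
    (hF : ∀ a b, F (eA a) (eB b) = v ↔ H a b)
    (hcard : 0 < (univ.filter fun z : X' × Y' => H z.1 z.2).card) :
    ENNReal.ofReal (Real.log ((univ.filter fun z : X' × Y' => H z.1 z.2).card / M)) ≤
      zeroErrorCC F := by
  refine le_iInf₂ fun P hP => ?_
  set s := univ.filter fun z : X' × Y' => H z.1 z.2 with hs
  have hae : ∀ᵐ r ∂coinMeasure, ∀ z : X' × Y',
      (P.tree r).output (eA z.1) (eB z.2) = F (eA z.1) (eB z.2) := by
    rw [ae_all_iff]
    intro z
    have hm := P.measurableSet_output (eA z.1) (eB z.2) (F (eA z.1) (eB z.2))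
    have h1 := hP (eA z.1) (eB z.2)
    rw [sub_zero] at h1
    have h2 : coinMeasure.real {r | (P.tree r).output (eA z.1) (eB z.2) =
        F (eA z.1) (eB z.2)} = 1 := le_antisymm measureReal_le_one h1
    have h3 : coinMeasure {r | (P.tree r).output (eA z.1) (eB z.2) =
        F (eA z.1) (eB z.2)} = 1 := by
      rw [measureReal_def] at h2
      exact (ENNReal.toReal_eq_one_iff _).1 h2
    exact (mem_ae_iff_prob_eq_one (μ := coinMeasure) hm).2 h3
  have hpt : ∀ᵐ r ∂coinMeasure,
      ENNReal.ofReal (s.card * Real.log (s.card / M)) ≤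
        ∑ z ∈ s, ((P.tree r).cost (eA z.1) (eB z.2) : ℝ≥0∞) := by
    filter_upwards [hae] with r hr
    have h1 := ProtocolTree.sum_pow_cost_le eA eB hM (P.tree r) univ univ (v := v)
      fun a _ b _ => by rw [hr (a, b), hF]
    rw [← sum_product', univ_product_univ, ← sum_filter] at h1
    have h2 := card_mul_log_le_sum s (fun z => (P.tree r).cost (eA z.1) (eB z.2)) hM0 hcard h1
    calc _ ≤ ENNReal.ofReal (∑ z ∈ s, ((P.tree r).cost (eA z.1) (eB z.2) : ℝ)) :=
          ENNReal.ofReal_le_ofReal h2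
      _ = _ := by
          rw [ENNReal.ofReal_sum_of_nonneg fun _ _ => Nat.cast_nonneg _]
          simp only [ENNReal.ofReal_natCast]
  have hc0 : (s.card : ℝ≥0∞) ≠ 0 := Nat.cast_ne_zero.2 hcard.ne'
  refine (ENNReal.mul_le_mul_iff_right hc0 (ENNReal.natCast_ne_top _)).1 ?_
  calc (s.card : ℝ≥0∞) * ENNReal.ofReal (Real.log (s.card / M))
      = ∫⁻ _, ENNReal.ofReal (s.card * Real.log (s.card / M)) ∂coinMeasure := by
        rw [lintegral_const, measure_univ, mul_one, ENNReal.ofReal_mul (Nat.cast_nonneg _),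
          ENNReal.ofReal_natCast]
    _ ≤ ∫⁻ r, ∑ z ∈ s, ((P.tree r).cost (eA z.1) (eB z.2) : ℝ≥0∞) ∂coinMeasure :=
        lintegral_mono_ae hpt
    _ = ∑ z ∈ s, ∫⁻ r, ((P.tree r).cost (eA z.1) (eB z.2) : ℝ≥0∞) ∂coinMeasure :=
        lintegral_finsetSum _ fun z _ =>
          (measurable_of_countable (fun c : ℕ => (c : ℝ≥0∞))).comp (P.measurable_cost _ _)
    _ ≤ ∑ _z ∈ s, P.expectedCost :=
        sum_le_sum fun z _ => le_iSup₂ (f := fun x y =>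
          ∫⁻ r, ((P.tree r).cost x y : ℝ≥0∞) ∂coinMeasure) (eA z.1) (eB z.2)
    _ = _ := by rw [sum_const, nsmul_eq_mul]

end PointerChasing

/-! ### Embedding pairs of permutations into pointer chasing -/

namespace PointerChasing

open Finset

/-- The orbit of `u` under `b * a` visits all vertices before it returns to `u`. -/
def FirstReturnAtEnd {α : Type*} [Fintype α] (u : α) (a b : Equiv.Perm α) : Prop :=
  ∀ l, 0 < l → l < Fintype.card α → ((b * a) ^ l) u ≠ u

section

variable {α : Type*} {u : α} {a b : Equiv.Perm α}

theorem alternate_pow_two_mul_inl (a b : Equiv.Perm α) (s : ℕ) (x : α) :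
    (alternate a b ^ (2 * s)) (Sum.inl x) = Sum.inl (((b * a) ^ s) x) := by
  induction s with
  | zero => rfl
  | succ s ih =>
    rw [Nat.mul_succ, Nat.add_comm, pow_add, Equiv.Perm.mul_apply, ih, pow_succ' (b * a)]
    rfl

variable [Fintype α]

theorem FirstReturnAtEnd.exists_pow_eq (h : FirstReturnAtEnd u a b) (x : α) :
    ∃ i < Fintype.card α, ((b * a) ^ i) u = x := by
  have hinj : Function.Injective fun i : Fin (Fintype.card α) => ((b * a) ^ (i : ℕ)) u := by
    intro k l hkl
    wlog hle : (k : ℕ) ≤ l generalizing k l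
    · exact (this hkl.symm (by omega)).symm
    by_contra hne
    obtain ⟨d, hd⟩ := Nat.exists_eq_add_of_le hle
    have hne' : (k : ℕ) ≠ l := fun he => hne (Fin.ext he)
    simp only at hkl
    rw [hd, pow_add, Equiv.Perm.mul_apply] at hkl
    exact h d (by omega) (by omega) (((b * a) ^ (k : ℕ)).injective hkl).symm
  have hbij := (Fintype.bijective_iff_injective_and_card _).2 ⟨hinj, Fintype.card_fin _⟩
  obtain ⟨i, hi⟩ := hbij.2 x
  exact ⟨i, i.2, hi⟩

theorem FirstReturnAtEnd.pow_card (h : FirstReturnAtEnd u a b) :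
    ((b * a) ^ Fintype.card α) u = u := by
  obtain ⟨i, hi, he⟩ := h.exists_pow_eq (((b * a) ^ Fintype.card α) u)
  obtain ⟨d, hd⟩ := Nat.exists_eq_add_of_le hi.le
  rcases Nat.eq_zero_or_pos i with rfl | hpos
  · exact he.symm
  · rw [hd, pow_add, Equiv.Perm.mul_apply] at he
    exact absurd (((b * a) ^ i).injective he).symm (h d (by omega) (by omega))

theorem FirstReturnAtEnd.hamiltonian (h : FirstReturnAtEnd u a b) : Hamiltonian a b := by
  have hinl : ∀ x : α, ∀ l, 0 < l → l < 2 * Fintype.card α →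
      (alternate a b ^ l) (Sum.inl x) ≠ Sum.inl x := by
    intro x l h0 hl he
    rcases Nat.even_or_odd' l with ⟨s, rfl | rfl⟩
    · rw [alternate_pow_two_mul_inl] at he
      have he' := Sum.inl_injective he
      obtain ⟨i, -, rfl⟩ := h.exists_pow_eq x
      rw [← Equiv.Perm.mul_apply, ← pow_add, Nat.add_comm, pow_add, Equiv.Perm.mul_apply] at he'
      exact h s (by omega) (by omega) (((b * a) ^ i).injective he')
    · rw [pow_succ', Equiv.Perm.mul_apply, alternate_pow_two_mul_inl] at he
      simp at he
  intro v l h0 hl he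
  rcases v with x | y
  · exact hinl x l h0 hl he
  · refine hinl (b y) l h0 hl ?_
    have h1 : alternate a b ((alternate a b ^ l) (Sum.inr y)) = alternate a b (Sum.inr y) := by
      rw [he]
    rwa [← Equiv.Perm.mul_apply, ← pow_succ', pow_succ, Equiv.Perm.mul_apply] at h1

end

open Classical in
/-- Among the pairs of permutations at least one in `m` has a single cycle as product. A triple
of a pair with cyclic product and a vertex encodes a pair `(a, g)`, where the product is the
conjugate by `g` of the rotation and the vertex is the image of `0` under `g`. -/
theorem factorial_sq_le_card_mul (m : ℕ) [NeZero m] :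
    m.factorial ^ 2 ≤ (univ.filter fun z : Equiv.Perm (ZMod m) × Equiv.Perm (ZMod m) =>
      FirstReturnAtEnd (0 : ZMod m) z.1 z.2).card * m := by
  set s := univ.filter fun z : Equiv.Perm (ZMod m) × Equiv.Perm (ZMod m) =>
      FirstReturnAtEnd (0 : ZMod m) z.1 z.2 with hs
  set rot : Equiv.Perm (ZMod m) := Equiv.addRight 1
  have hrot : ∀ (l : ℕ) (x : ZMod m), (rot ^ l) x = x + l := by
    intro l x
    induction l with
    | zero => simp
    | succ l ih =>
      rw [pow_succ', Equiv.Perm.mul_apply, ih]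
      change x + l + 1 = _
      push_cast
      ring
  let Φ : Equiv.Perm (ZMod m) × Equiv.Perm (ZMod m) →
      (Equiv.Perm (ZMod m) × Equiv.Perm (ZMod m)) × ZMod m :=
    fun z => ((z.1, z.2 * rot * z.2⁻¹ * z.1⁻¹), z.2 0)
  have hΦ : ∀ z, Φ z ∈ s ×ˢ (univ : Finset (ZMod m)) := by
    rintro ⟨a, g⟩
    rw [mem_product, hs, mem_filter]
    refine ⟨⟨mem_univ _, fun l h0 hl he => ?_⟩, mem_univ _⟩
    simp only [Φ, inv_mul_cancel_right, conj_pow] at he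
    have h1 : (rot ^ l) (g⁻¹ 0) = g⁻¹ 0 := by
      rw [Equiv.Perm.mul_apply, Equiv.Perm.mul_apply] at he
      exact (Equiv.Perm.eq_inv_iff_eq).2 he
    rw [hrot, add_eq_left, ZMod.natCast_eq_zero_iff] at h1
    rw [ZMod.card] at hl
    exact absurd (Nat.le_of_dvd h0 h1) (by omega)
  have hinj : Function.Injective Φ := by
    rintro ⟨a, g⟩ ⟨a', g'⟩ he
    simp only [Φ, Prod.mk.injEq] at he
    obtain ⟨⟨rfl, h1⟩, h2⟩ := he
    have h3 : g * rot * g⁻¹ = g' * rot * g'⁻¹ := mul_right_cancel h1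
    have h4 : ∀ (g : Equiv.Perm (ZMod m)) (x : ZMod m),
        ((g * rot * g⁻¹) ^ x.val) (g 0) = g x := by
      intro g x
      rw [conj_pow, Equiv.Perm.mul_apply, Equiv.Perm.mul_apply,
        show g⁻¹ (g 0) = 0 from g.symm_apply_apply 0, hrot,
        zero_add, ZMod.natCast_zmod_val]
    rw [Prod.mk.injEq]
    refine ⟨rfl, Equiv.ext fun x => ?_⟩
    rw [← h4 g, ← h4 g', h3, h2]
  have h5 := card_le_card_of_injOn (s := univ) Φ (fun z _ => hΦ z) hinj.injOn
  rw [card_product, card_univ, card_univ, Fintype.card_prod, Fintype.card_perm, ZMod.card] at h5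
  rw [sq]
  exact h5

theorem walkA_two_mul {n : ℕ} (NA NB : Fin n → Fin n) (s : ℕ) (x : Fin n) :
    walkA NA NB (2 * s) x = (fun y => NB (NA y))^[s] x := by
  induction s generalizing x with
  | zero => rfl
  | succ s ih =>
    rw [Function.iterate_succ_apply, ← ih]
    rfl

section

variable {n : ℕ} [NeZero n] {α : Type} (φ : α → Fin n) (u : α) (t l : Fin n)

open Classical in
/-- The first player's pointers: they follow `a` between the copies `φ` of `α` on either side.
The vertex `0` serves as the vertex `u` at the start, and `t` on the other side is a dead end. -/
noncomputable def outPointers (a : Equiv.Perm α) (x : Fin n) : Fin n :=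
  if x = 0 then φ (a u) else if h : ∃ i, φ i = x then φ (a h.choose) else t

open Classical in
/-- The second player's pointers: they follow `b`, except that the vertex `u` is replaced as a
target by `t`. The dead end `t` of the other side leads to `l`. -/
noncomputable def backPointers (b : Equiv.Perm α) (x : Fin n) : Fin n :=
  if x = 0 then 0 else if h : ∃ i, φ i = x then
    (if b h.choose = u then t else φ (b h.choose)) else l

variable {φ u t l}

theorem outPointers_apply (hφ : Function.Injective φ) (h0 : ∀ i, φ i ≠ 0) (a : Equiv.Perm α)
    (i : α) : outPointers φ u t a (φ i) = φ (a i) := by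
  have h : ∃ j, φ j = φ i := ⟨i, rfl⟩
  rw [outPointers, if_neg (h0 i), dif_pos h, hφ h.choose_spec]

open Classical in
theorem backPointers_apply (hφ : Function.Injective φ) (h0 : ∀ i, φ i ≠ 0) (b : Equiv.Perm α)
    (i : α) : backPointers φ u t l b (φ i) = if b i = u then t else φ (b i) := by
  have h : ∃ j, φ j = φ i := ⟨i, rfl⟩
  rw [backPointers, if_neg (h0 i), dif_pos h, hφ h.choose_spec]

/-- After `2 |α|` steps the walk from `0` is at `t` if the orbit of `u` has returned for the first
time only then, and otherwise in the dead end `l`. -/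
theorem walkA_embedded [Fintype α] (hφ : Function.Injective φ) (h0 : ∀ i, φ i ≠ 0)
    (ht : ∀ i, φ i ≠ t) (hl : ∀ i, φ i ≠ l) (ht0 : t ≠ 0) (hl0 : l ≠ 0) (a b : Equiv.Perm α) :
    (FirstReturnAtEnd u a b → walkA (outPointers φ u t a) (backPointers φ u t l b)
      (2 * Fintype.card α) 0 = t) ∧
    (¬ FirstReturnAtEnd u a b → walkA (outPointers φ u t a) (backPointers φ u t l b)
      (2 * Fintype.card α) 0 = l) := by
  classical
  rw [walkA_two_mul]
  set step := fun y => backPointers φ u t l b (outPointers φ u t a y) with hstep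
  have hdead : backPointers φ u t l b t = l := by
    rw [backPointers, if_neg ht0, dif_neg (by rintro ⟨i, hi⟩; exact ht i hi)]
  have hst : step t = l := by
    have : outPointers φ u t a t = t := by
      rw [outPointers, if_neg ht0, dif_neg (by rintro ⟨i, hi⟩; exact ht i hi)]
    rw [hstep]; simp only [this, hdead]
  have hsl : step l = l := by
    have : outPointers φ u t a l = t := by
      rw [outPointers, if_neg hl0, dif_neg (by rintro ⟨i, hi⟩; exact hl i hi)]
    rw [hstep]; simp only [this, hdead]
  have hs0 : step 0 = if (b * a) u = u then t else φ ((b * a) u) := by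
    have : outPointers φ u t a 0 = φ (a u) := by rw [outPointers, if_pos rfl]
    rw [hstep]; simp only [this, backPointers_apply hφ h0]; rfl
  have hsφ : ∀ i, step (φ i) = if (b * a) i = u then t else φ ((b * a) i) := by
    intro i
    rw [hstep]; simp only [outPointers_apply hφ h0, backPointers_apply hφ h0]; rfl
  have hwalk : ∀ s, (∀ r, 0 < r → r < s + 1 → ((b * a) ^ r) u ≠ u) →
      step^[s + 1] 0 = if ((b * a) ^ (s + 1)) u = u then t else φ (((b * a) ^ (s + 1)) u) := by
    intro s
    induction s with
    | zero => intro _; rw [zero_add, pow_one, Function.iterate_one, hs0]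
    | succ s ih =>
      intro h
      rw [Function.iterate_succ_apply', ih fun r h1 h2 => h r h1 (by omega),
        if_neg (h (s + 1) (by omega) (by omega)), hsφ, ← Equiv.Perm.mul_apply, ← pow_succ']
  have hcard : 0 < Fintype.card α := Fintype.card_pos_iff.2 ⟨u⟩
  constructor
  · intro h
    obtain ⟨s, hs⟩ : ∃ s, Fintype.card α = s + 1 := ⟨Fintype.card α - 1, by omega⟩
    rw [hs, hwalk s fun r h1 h2 => h r h1 (by omega), ← hs, if_pos h.pow_card]
  · intro h
    unfold FirstReturnAtEnd at h
    push Not at h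
    have hex : ∃ r, 0 < r ∧ r < Fintype.card α ∧ ((b * a) ^ r) u = u := h
    obtain ⟨h1, h2, h3⟩ := Nat.find_spec hex
    set r := Nat.find hex
    obtain ⟨s, hs⟩ : ∃ s, r = s + 1 := ⟨r - 1, by omega⟩
    have h4 := hwalk s fun r' h5 h6 h7 =>
      Nat.find_min hex (m := r') (by omega) ⟨h5, by omega, h7⟩
    rw [← hs, if_pos h3] at h4
    obtain ⟨d, hd⟩ : ∃ d, Fintype.card α = d + 1 + r := ⟨Fintype.card α - r - 1, by omega⟩
    rw [hd, Function.iterate_add_apply, h4, Function.iterate_succ_apply, hst]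
    exact Function.iterate_fixed hsl d

end

/-- The zero-error complexity of pointer chasing is at least the logarithm of the ratio of the
number of pairs with cyclic product to the size of the largest rectangle of such pairs. -/
theorem log_le_zeroErrorCC_pointerChasing {n k m : ℕ} [NeZero n] [NeZero m]
    (hk : k = 2 * m ∨ k = 2 * m + 1) (hn : m + 3 ≤ n) {f : Fin n → Bool} (hf : NonTrivial f)
    {M : ℝ} (hM0 : 0 < M)
    (hM : ∀ A B : Finset (Equiv.Perm (ZMod m)), (∀ a ∈ A, ∀ b ∈ B, Hamiltonian a b) →
      (A.card : ℝ) * B.card ≤ M) :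
    ENNReal.ofReal (Real.log (m.factorial ^ 2 / m / M)) ≤ zeroErrorCC (pointerChasing f k) := by
  classical
  obtain ⟨t, l, ht0, hl0, htl⟩ := hf
  have hm0 : 0 < m := Nat.pos_of_neZero m
  have hmR : (0 : ℝ) < m := Nat.cast_pos.2 hm0
  obtain ⟨φ⟩ : Nonempty (ZMod m ↪ {x : Fin n // x ∉ ({0, t, l} : Finset (Fin n))}) := by
    apply Function.Embedding.nonempty_of_card_le
    rw [ZMod.card, Fintype.card_subtype_compl, Fintype.card_fin, Fintype.card_coe]
    have := card_le_three (a := (0 : Fin n)) (b := t) (c := l)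
    omega
  set ψ : ZMod m → Fin n := fun i => (φ i).1 with hψ
  have hψi : Function.Injective ψ := fun i j h => φ.injective (Subtype.ext h)
  have hne : ∀ i, ψ i ≠ 0 ∧ ψ i ≠ t ∧ ψ i ≠ l := by
    intro i
    have := (φ i).2
    simpa using this
  have hwalk := fun a b : Equiv.Perm (ZMod m) => walkA_embedded (u := (0 : ZMod m)) hψi
    (fun i => (hne i).1) (fun i => (hne i).2.1) (fun i => (hne i).2.2) ht0 hl0 a b
  rw [ZMod.card] at hwalk
  have hval : ∀ a b : Equiv.Perm (ZMod m), f (walkA (outPointers ψ 0 t a)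
      (backPointers ψ 0 t l b) (2 * m) 0) = f t ↔ FirstReturnAtEnd (0 : ZMod m) a b := by
    intro a b
    by_cases h : FirstReturnAtEnd (0 : ZMod m) a b
    · rw [(hwalk a b).1 h]; exact iff_of_true rfl h
    · rw [(hwalk a b).2 h]; exact iff_of_false htl.symm h
  have hcard := factorial_sq_le_card_mul m
  have hfac : 0 < m.factorial ^ 2 := pow_pos m.factorial_pos 2
  set s := univ.filter fun z : Equiv.Perm (ZMod m) × Equiv.Perm (ZMod m) =>
    FirstReturnAtEnd (0 : ZMod m) z.1 z.2 with hs
  have hspos : 0 < s.card := Nat.pos_of_mul_pos_right (hfac.trans_le hcard)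
  have hmono : ENNReal.ofReal (Real.log (m.factorial ^ 2 / m / M)) ≤
      ENNReal.ofReal (Real.log (s.card / M)) := by
    apply ENNReal.ofReal_le_ofReal
    have hfac' : (0 : ℝ) < (m.factorial : ℝ) ^ 2 := by exact_mod_cast hfac
    apply Real.log_le_log (by positivity)
    gcongr
    rw [div_le_iff₀ hmR]
    exact_mod_cast hcard
  refine hmono.trans ?_
  rcases hk with rfl | rfl
  · exact le_zeroErrorCC _ (outPointers ψ 0 t) (backPointers ψ 0 t l)
      (H := FirstReturnAtEnd (0 : ZMod m)) (v := f t) hM0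
      (fun A B h => hM A B fun a ha b hb => (h a ha b hb).hamiltonian) hval hspos
  · -- for odd `k` the first step stays at `0`, and the players exchange their roles
    have hswap : s.card = (univ.filter fun z : Equiv.Perm (ZMod m) × Equiv.Perm (ZMod m) =>
        FirstReturnAtEnd (0 : ZMod m) z.2 z.1).card := by
      refine card_bij (fun z _ => z.swap) (fun z hz => ?_) (fun _ _ _ _ h => Prod.swap_injective h)
        fun z hz => ⟨z.swap, ?_, by simp⟩
      · simpa [hs] using hz
      · simpa [hs] using hz
    rw [hswap] at hspos ⊢
    refine le_zeroErrorCC _ (backPointers ψ 0 t l) (outPointers ψ 0 t)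
      (H := fun b a => FirstReturnAtEnd (0 : ZMod m) a b) (v := f t) hM0
      (fun B A h => ?_) (fun b a => ?_) hspos
    · rw [mul_comm]
      exact hM A B fun a ha b hb => (h b hb a ha).hamiltonian
    · rw [← hval a b]
      have h0 : backPointers ψ 0 t l b 0 = 0 := by rw [backPointers, if_pos rfl]
      have : walkA (backPointers ψ 0 t l b) (outPointers ψ 0 t a) (2 * m + 1) 0 =
          walkA (outPointers ψ 0 t a) (backPointers ψ 0 t l b) (2 * m) 0 := by
        rw [walkA_succ, h0]; rfl
      rw [pointerChasing, this]

end PointerChasing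

/-! ### The lower bound -/

namespace PointerChasing

/-- For `m` about half of `k`, the bound `m log log m / 180` dominates both `log m` and a multiple
of `k log log k`. -/
theorem mul_log_log_le {k m : ℕ} (hk : k ≤ 3 * m) (hm : Real.exp (Real.exp 900) ≤ m)
    (hmk : 9 ≤ k) :
    1 / 2160 * ((k : ℝ) * Real.log (Real.log k)) ≤
      1 / 180 * (m * Real.log (Real.log m)) - Real.log m := by
  have hmR : (0 : ℝ) < m := (Real.exp_pos _).trans_le hm
  have hkR : (k : ℝ) ≤ 3 * m := by exact_mod_cast hk
  have hk9 : (9 : ℝ) ≤ k := by exact_mod_cast hmk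
  have hlog : Real.exp 900 ≤ Real.log m := by
    rw [← Real.log_exp (Real.exp 900)]; exact Real.log_le_log (Real.exp_pos _) hm
  have hlogpos : 0 < Real.log m := (Real.exp_pos _).trans_le hlog
  have hLL : 900 ≤ Real.log (Real.log m) := by
    rw [← Real.log_exp 900]; exact Real.log_le_log (Real.exp_pos _) hlog
  -- `log m ≤ 2 √m`, and `√m` is large
  have h1 : Real.log m ≤ m := by
    have := Real.log_le_sub_one_of_pos hmR; linarith
  have hsq : Real.log m ≤ 2 * √m := by
    have h2 := Real.log_le_sub_one_of_pos (Real.sqrt_pos.2 hmR)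
    rw [Real.log_sqrt hmR.le] at h2
    linarith
  have hexp : (900 : ℝ) ≤ Real.exp 900 := by
    have := Real.add_one_le_exp (900 : ℝ); linarith
  have h900 : 900 ≤ 2 * √m := hexp.trans (hlog.trans hsq)
  have h2 : Real.log m ≤ 1 / 360 * (m * Real.log (Real.log m)) := by
    have h3 : √m * √m = m := Real.mul_self_sqrt hmR.le
    have h4 : (m : ℝ) * 900 ≤ m * Real.log (Real.log m) := by gcongr
    nlinarith
  -- `k ≤ 3 m ≤ m ^ 2`
  have hlogk : Real.log k ≤ 2 * Real.log m := by
    have h5 : (k : ℝ) ≤ (m : ℝ) ^ 2 := by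
      have : (900 : ℝ) ≤ m := by linarith
      nlinarith
    have := Real.log_le_log (by linarith) h5
    rwa [Real.log_pow] at this
  have hlogk0 : 0 < Real.log k := Real.log_pos (by linarith)
  have h6 : Real.log (Real.log k) ≤ 2 * Real.log (Real.log m) := by
    have h7 := Real.log_le_log hlogk0 hlogk
    rw [Real.log_mul two_ne_zero hlogpos.ne'] at h7
    have := Real.log_two_lt_d9
    linarith
  have h8 : (k : ℝ) * Real.log (Real.log k) ≤ 3 * m * (2 * Real.log (Real.log m)) := by
    calc (k : ℝ) * Real.log (Real.log k) ≤ k * (2 * Real.log (Real.log m)) := by gcongr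
      _ ≤ _ := by gcongr
  linarith

end PointerChasing

/-- The constants `c` and `k₀` are absolute: they do not depend on `k`, `n` or `f`. -/
theorem theorem4 :
    ∃ c : ℝ, 0 < c ∧ ∃ k₀ : ℕ, ∀ k : ℕ, k₀ ≤ k →
      ∀ (n : ℕ) [NeZero n], 4 * k ≤ n →
        ∀ f : Fin n → Bool, PointerChasing.NonTrivial f →
          ENNReal.ofReal (c * ((k : ℝ) * Real.log (Real.log (k : ℝ)))) ≤
            PointerChasing.zeroErrorCC (PointerChasing.pointerChasing f k) := by
  refine ⟨1 / 2160, by norm_num, 3 * ⌈Real.exp (Real.exp 900)⌉₊ + 9, fun k hk n _ hn f hf => ?_⟩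
  obtain ⟨m, hm⟩ : ∃ m, k = 2 * m ∨ k = 2 * m + 1 := ⟨k / 2, by omega⟩
  have hkm : k ≤ 3 * m := by omega
  have hmexp : Real.exp (Real.exp 900) ≤ m :=
    (Nat.le_ceil _).trans (Nat.cast_le.2 (by omega))
  have : NeZero m := ⟨by omega⟩
  have hmR : (0 : ℝ) < m := (Real.exp_pos _).trans_le hmexp
  have hfac : (0 : ℝ) < m.factorial := Nat.cast_pos.2 m.factorial_pos
  refine le_trans (ENNReal.ofReal_le_ofReal ?_)
    (PointerChasing.log_le_zeroErrorCC_pointerChasing hm (by omega) hf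
      (M := (m.factorial : ℝ) ^ 2 * Real.exp (-(1 / 180 * (m * Real.log (Real.log m)))))
      (by positivity) fun A B h => ?_)
  · refine (PointerChasing.mul_log_log_le hkm hmexp (by omega)).trans (le_of_eq ?_)
    have : (m.factorial : ℝ) ^ 2 / m /
        (m.factorial ^ 2 * Real.exp (-(1 / 180 * (m * Real.log (Real.log m))))) =
        Real.exp (1 / 180 * (m * Real.log (Real.log m))) / m := by
      rw [Real.exp_neg]
      field_simp
    rw [this, Real.log_div (Real.exp_pos _).ne' hmR.ne', Real.log_exp]
  · have h1 := PointerChasing.card_mul_card_le_of_hamiltonian h (by rwa [ZMod.card])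
    rwa [ZMod.card] at h1
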